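/- Fix $\beta>0$ and $0<d\le 1$. For $m\ge 1$ set $a=m\beta/(2d)$, and let $(\lambda_1,\dots,\lambda_m)$ be distributed as the $\beta$-Laguerre ensemble of size $m$ with parameter $a$, i.e. with joint density on $(0,\infty)^m$ \[ f_{\beta,a}(\lambda)=Z_{\beta,m}^{-1}\prod_{i<j}|\lambda_i-\lambda_j|^{\beta}\,\prod_{i=1}^m\lambda_i^{\,a-\frac{\beta}{2}(m-1)-1}\,e^{-\frac{\beta}{2}\sum_{i=1}^m\lambda_i}, \] where $Z_{\beta,m}$ is the normalizing constant. For an interval $I\subset\mathbb{R}$ let $N_I$ be the number of indices $i$ such that the rescaled eigenvalue $\frac{d}{m}\lambda_i$ lies in $I$ (these rescaled points have the law of the eigenvalues of $\frac{d}{\beta m}B_\beta B_\beta^t$, where $B_\beta$ is the $m\times m$ lower bidiagonal matrix with independent entries, $\chi_{2a},\chi_{2a-\beta},\dots,\chi_{2a-\beta(m-1)}$ on the diagonal and $\chi_{\beta(m-1)},\dots,\chi_{\beta}$ below it). Let $\lambda_\pm=(1\pm\sqrt d)^2$ and \[ \rho_{MP,d}(x)=\frac{1}{2d\pi x}\sqrt{(\lambda_+-x)(x-\lambda_-)}\;\mathbf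 1_{[\lambda_-,\lambda_+]}(x). \] Then for all $\delta,\kappa,\epsilon>0$ and every $k>0$ there is a constant $C=C_{\delta,\kappa,\epsilon,k}$ (depending also on the fixed $\beta,d$) such that for every integer $m\ge 1$ and every $E\in(\lambda_-+\kappa,\lambda_+-\kappa)$, \[ \mathbb{P}\left(\left|\frac1m N_{[E-m^{-1+\epsilon},\,E+m^{-1+\epsilon}]}-\int_{E-m^{-1+\epsilon}}^{E+m^{-1+\epsilon}}\rho_{MP,d}(x)\,dx\right|\ge\delta m^{-1+\epsilon}\right)\le C\,m^{-k}. \] -/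

import Mathlib

open MeasureTheory Set

/-- The unnormalized joint density of the `β`-Laguerre ensemble of size `m` with parameter `a`,
`∏_{i<j} |λ_i - λ_j|^β · ∏_i λ_i^{a - β(m-1)/2 - 1} · exp(-(β/2) ∑_i λ_i)`,
supported on vectors with positive coordinates. -/
noncomputable def laguerreWeight (m : ℕ) (β a : ℝ) (x : Fin m → ℝ) : ℝ :=
  open Classical in
  if ∀ i, 0 < x i then
    (∏ i, ∏ j ∈ Finset.Ioi i, |x i - x j| ^ β)
      * (∏ i, x i ^ (a - β / 2 * ((m : ℝ) - 1) - 1))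
      * Real.exp (-(β / 2) * ∑ i, x i)
  else 0

/-- The `β`-Laguerre ensemble of size `m` with parameter `a`: the law on `ℝ^m` of the
(unordered) eigenvalues, i.e. the measure whose Lebesgue density is proportional to
`laguerreWeight m β a`, divided by its total mass. -/
noncomputable def laguerreEnsemble (m : ℕ) (β a : ℝ) : Measure (Fin m → ℝ) :=
  (∫⁻ x : Fin m → ℝ, ENNReal.ofReal (laguerreWeight m β a x))⁻¹ •
    (volume : Measure (Fin m → ℝ)).withDensity
      (fun x => ENNReal.ofReal (laguerreWeight m β a x))

/-- The number of indices `i` such that the rescaled eigenvalue `(d / m) λ_i` lies in `I`.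
With the weight `exp(-(β/2) ∑ λ_i)` above, the `λ_i` are distributed as the eigenvalues of
`β⁻¹ B Bᵗ`, where `B` is the bidiagonal matrix with independent chi-distributed entries
`χ_{2a - β(i-1)}` on the diagonal and `χ_{β(m-i)}` below it; so the `(d / m) λ_i` are distributed
as the eigenvalues of the normalized matrix `(d / (β m)) B Bᵗ`. -/
noncomputable def rescaledCount (m : ℕ) (d : ℝ) (x : Fin m → ℝ) (I : Set ℝ) : ℕ :=
  Nat.card {i : Fin m // d / (m : ℝ) * x i ∈ I}

/-- Lower edge of the Marchenko-Pastur law with ratio `d`. -/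
noncomputable def mpLower (d : ℝ) : ℝ := (1 - √d) ^ 2

/-- Upper edge of the Marchenko-Pastur law with ratio `d`. -/
noncomputable def mpUpper (d : ℝ) : ℝ := (1 + √d) ^ 2

/-- Density of the Marchenko-Pastur law with ratio `d`. -/
noncomputable def mpDensity (d x : ℝ) : ℝ :=
  (Icc (mpLower d) (mpUpper d)).indicator
    (fun x => 1 / (2 * d * Real.pi * x) * √((mpUpper d - x) * (x - mpLower d))) x

theorem laguerreWeight_nonneg (m : ℕ) (β a : ℝ) (x : Fin m → ℝ) :
    0 ≤ laguerreWeight m β a x := by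
  unfold laguerreWeight
  split_ifs with h
  · have := fun i => (h i).le
    refine mul_nonneg (mul_nonneg ?_ ?_) (Real.exp_pos _).le
    · exact Finset.prod_nonneg fun i _ => Finset.prod_nonneg fun j _ =>
        Real.rpow_nonneg (abs_nonneg _) _
    · exact Finset.prod_nonneg fun i _ => Real.rpow_nonneg (this i) _
  · exact le_rfl

theorem measurable_laguerreWeight (m : ℕ) (β a : ℝ) : Measurable (laguerreWeight m β a) := by
  unfold laguerreWeight
  refine Measurable.ite ?_ ?_ measurable_const
  · rw [Set.ofPred_forall]
    exact MeasurableSet.iInter fun i => measurableSet_lt measurable_const (measurable_pi_apply i)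
  · fun_prop

theorem lintegral_laguerreWeight_ne_top (m : ℕ) (β a : ℝ) (hβ : 0 < β)
    (ha : β / 2 * ((m : ℝ) - 1) < a) :
    ∫⁻ x : Fin m → ℝ, ENNReal.ofReal (laguerreWeight m β a x) ≠ ⊤ := by
  set α : ℝ := a - β / 2 * ((m : ℝ) - 1) - 1 with hα
  set p : ℝ := β * m + β * m with hp
  have hp0 : 0 ≤ p := by positivity
  have hα1 : -1 < α := by linarith
  let g : ℝ → ℝ := (Ioi (0 : ℝ)).indicator
    (fun t => 2 ^ p * (t ^ α * Real.exp (-(β / 2) * t ^ (1 : ℝ))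
      + t ^ (p + α) * Real.exp (-(β / 2) * t ^ (1 : ℝ))))
  have hg : Integrable g := by
    refine (integrable_indicator_iff measurableSet_Ioi).2 ?_
    refine Integrable.const_mul (Integrable.add ?_ ?_) _
    · exact integrableOn_rpow_mul_exp_neg_mul_rpow hα1 zero_lt_one (by positivity)
    · exact integrableOn_rpow_mul_exp_neg_mul_rpow (by linarith) zero_lt_one (by positivity)
  have hG : Integrable (fun x : Fin m → ℝ => ∏ i, g (x i)) :=
    Integrable.fintype_prod (f := fun _ => g) (fun _ => hg)
  refine ne_top_of_le_ne_top hG.lintegral_lt_top.ne (lintegral_mono fun x => ?_)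
  refine ENNReal.ofReal_le_ofReal ?_
  have hg0 : ∀ t, 0 ≤ g t := fun t => Set.indicator_nonneg (fun t ht => by
    have : (0 : ℝ) < t := ht
    positivity) t
  unfold laguerreWeight
  split_ifs with h
  · have h1 : ∏ i, ∏ j ∈ Finset.Ioi i, |x i - x j| ^ β ≤ ∏ i, (1 + x i) ^ p := by
      calc ∏ i, ∏ j ∈ Finset.Ioi i, |x i - x j| ^ β
          ≤ ∏ i, ∏ j ∈ Finset.Ioi i, ((1 + x i) ^ β * (1 + x j) ^ β) := by
            refine Finset.prod_le_prod (fun i _ => Finset.prod_nonneg fun j _ => by positivity)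
              fun i _ => Finset.prod_le_prod (fun j _ => by positivity) fun j _ => ?_
            have hi := h i
            have hj := h j
            rw [← Real.mul_rpow (by positivity) (by positivity)]
            refine Real.rpow_le_rpow (abs_nonneg _) ?_ hβ.le
            rw [abs_le]
            constructor <;> nlinarith [mul_pos hi hj]
        _ ≤ ∏ i, ∏ j, ((1 + x i) ^ β * (1 + x j) ^ β) := by
            have h1 : ∀ i, 1 ≤ (1 + x i) ^ β := fun i =>
              Real.one_le_rpow (by linarith [h i]) hβ.le
            refine Finset.prod_le_prod (fun i _ => Finset.prod_nonneg fun j _ => ?_) fun i _ => ?_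
            · exact mul_nonneg (by linarith [h1 i]) (by linarith [h1 j])
            · have h2 : ∀ j, 1 ≤ (1 + x i) ^ β * (1 + x j) ^ β := fun j =>
                one_le_mul_of_one_le_of_one_le (h1 i) (h1 j)
              rw [← Finset.prod_sdiff (Finset.subset_univ (Finset.Ioi i))]
              refine le_mul_of_one_le_left
                (Finset.prod_nonneg fun j _ => zero_le_one.trans (h2 j)) ?_
              exact Finset.prod_induction _ (fun t : ℝ => 1 ≤ t)
                (fun _ _ => one_le_mul_of_one_le_of_one_le) le_rfl fun j _ => h2 j
        _ = ∏ i, (1 + x i) ^ p := by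
            simp_rw [Finset.prod_mul_distrib, Finset.prod_const]
            rw [← Finset.prod_pow]
            rw [Finset.card_univ, Fintype.card_fin, ← Finset.prod_mul_distrib]
            refine Finset.prod_congr rfl fun i _ => ?_
            have := h i
            rw [hp, Real.rpow_add (by linarith), Real.rpow_mul_natCast (by linarith)]
    have h2 : Real.exp (-(β / 2) * ∑ i, x i) = ∏ i, Real.exp (-(β / 2) * x i) := by
      rw [← Real.exp_sum, Finset.mul_sum]
    rw [h2, ← hα]
    have hx : ∀ i, 0 < 1 + x i := fun i => by linarith [h i]
    calc _ ≤ (∏ i, (1 + x i) ^ p) * (∏ i, x i ^ α) * ∏ i, Real.exp (-(β / 2) * x i) := by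
            have := h
            have hA : 0 ≤ ∏ i, x i ^ α :=
              Finset.prod_nonneg fun i _ => Real.rpow_nonneg (h i).le _
            have hB : 0 ≤ ∏ i, Real.exp (-(β / 2) * x i) :=
              Finset.prod_nonneg fun i _ => (Real.exp_pos _).le
            gcongr
      _ = ∏ i, ((1 + x i) ^ p * x i ^ α * Real.exp (-(β / 2) * x i)) := by
            rw [← Finset.prod_mul_distrib, ← Finset.prod_mul_distrib]
      _ ≤ ∏ i, g (x i) := by
            refine Finset.prod_le_prod (fun i _ => ?_) fun i _ => ?_
            · exact mul_nonneg (mul_nonneg (Real.rpow_nonneg (hx i).le _)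
                (Real.rpow_nonneg (h i).le _)) (Real.exp_pos _).le
            · have hi := h i
              simp only [g, Set.indicator_of_mem (show x i ∈ Ioi (0 : ℝ) from hi), Real.rpow_one]
              have : (1 + x i) ^ p ≤ 2 ^ p * (1 + x i ^ p) := by
                rcases le_total (x i) 1 with h1 | h1
                · have : (1 + x i) ^ p ≤ 2 ^ p := Real.rpow_le_rpow (hx i).le (by linarith) hp0
                  have h3 : 0 ≤ (2 : ℝ) ^ p * x i ^ p := by positivity
                  linarith
                · have : (1 + x i) ^ p ≤ (2 * x i) ^ p :=
                    Real.rpow_le_rpow (hx i).le (by linarith) hp0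
                  rw [Real.mul_rpow (by norm_num) hi.le] at this
                  have h3 : 0 ≤ (2 : ℝ) ^ p := by positivity
                  linarith
              calc _ ≤ 2 ^ p * (1 + x i ^ p) * x i ^ α * Real.exp (-(β / 2) * x i) := by
                      gcongr
                _ = _ := by
                      rw [Real.rpow_add hi p α]
                      ring
  · exact Finset.prod_nonneg fun i _ => hg0 _

theorem lintegral_laguerreWeight_ne_zero (m : ℕ) (β a : ℝ) :
    ∫⁻ x : Fin m → ℝ, ENNReal.ofReal (laguerreWeight m β a x) ≠ 0 := by
  have hm := (measurable_laguerreWeight m β a).ennreal_ofReal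
  intro h0
  rw [lintegral_eq_zero_iff hm] at h0
  let U : Set (Fin m → ℝ) := {x | ∀ i : Fin m, x i ∈ Ioo ((i : ℝ) + 1) ((i : ℝ) + 2)}
  have hU : U = Set.pi univ fun i : Fin m => Ioo ((i : ℝ) + 1) ((i : ℝ) + 2) := by
    ext x; simp [U]
  have hUo : IsOpen U := by
    rw [hU]; exact isOpen_set_pi finite_univ fun i _ => isOpen_Ioo
  have hUn : U.Nonempty := ⟨fun i => (i : ℝ) + 3 / 2, fun i =>
    ⟨by dsimp only; linarith, by dsimp only; linarith⟩⟩
  have hpos : ∀ x ∈ U, ENNReal.ofReal (laguerreWeight m β a x) ≠ 0 := by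
    intro x hx
    have hx0 : ∀ i, 0 < x i := fun i => by
      have := (hx i).1
      have h2 : (0 : ℝ) ≤ (i : ℝ) := Nat.cast_nonneg _
      linarith
    have : 0 < laguerreWeight m β a x := by
      unfold laguerreWeight
      rw [if_pos hx0]
      refine mul_pos (mul_pos ?_ ?_) (Real.exp_pos _)
      · refine Finset.prod_pos fun i _ => Finset.prod_pos fun j hj => ?_
        refine Real.rpow_pos_of_pos (abs_pos.2 ?_) _
        have hij : (i : ℕ) + 1 ≤ (j : ℕ) := by simpa using Finset.mem_Ioi.1 hj
        have hij' : (i : ℝ) + 1 ≤ (j : ℝ) := by exact_mod_cast hij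
        have h1 := (hx i).2
        have h2 := (hx j).1
        intro h3
        linarith
      · exact Finset.prod_pos fun i _ => Real.rpow_pos_of_pos (hx0 i) _
    simpa using this
  have : volume U = 0 := measure_mono_null (fun x hx => hpos x hx) h0
  exact (hUo.measure_pos volume hUn).ne' this

/-- In the admissible range `a > β (m - 1) / 2` the ensemble is a probability measure. -/
theorem isProbabilityMeasure_laguerreEnsemble (m : ℕ) (β a : ℝ) (hβ : 0 < β)
    (ha : β / 2 * ((m : ℝ) - 1) < a) : IsProbabilityMeasure (laguerreEnsemble m β a) := by
  refine ⟨?_⟩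
  unfold laguerreEnsemble
  rw [Measure.smul_apply, withDensity_apply _ MeasurableSet.univ, Measure.restrict_univ,
    smul_eq_mul]
  exact ENNReal.inv_mul_cancel (lintegral_laguerreWeight_ne_zero m β a)
    (lintegral_laguerreWeight_ne_top m β a hβ ha)

theorem isProbabilityMeasure_laguerreEnsemble' (m : ℕ) (β d : ℝ) (hβ : 0 < β) (hd : 0 < d)
    (hd1 : d ≤ 1) : IsProbabilityMeasure (laguerreEnsemble m β (m * β / (2 * d))) := by
  refine isProbabilityMeasure_laguerreEnsemble m β _ hβ ?_
  rw [lt_div_iff₀ (by positivity)]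
  have hm : (0 : ℝ) ≤ m := Nat.cast_nonneg m
  nlinarith [mul_nonneg hm (sub_nonneg.2 hd1), mul_pos hβ hd,
    mul_nonneg hβ.le (mul_nonneg hm (sub_nonneg.2 hd1))]

/-!
The proof works directly with the density of the ensemble, through its loop equation.

Write `y_i = (d / m) x_i` and let `s = s(z)` be the Stieltjes transform of the empirical measure of
the `y_i` (`empStieltjes`). Integrating the density by parts against the vector field
`x_i / (x_i - Z) · F`, `Z = (m / d) z`, the singular pair interactions symmetrize to
`∑_{k < l} 1 / ((x_k - Z) (x_l - Z))`, and the factor `x_i` in the vector field both kills the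
boundary term at the hard edge `0` and makes the result algebraic in `s`: it says that
`Q(s) = z s² + ((z - 1 + d) / d) s + 1 / d` (`mpQuad`), the polynomial defining the
Marchenko-Pastur law, vanishes up to explicit error terms
(`integral_loop_laguerreEnsemble`). For `β < 1` the derivative of the density is unbounded near
coincidences, so the integration by parts is done for the smooth weight
`∏ ((x_k - x_l)² + τ)^{β/2} ⋯` and `τ → 0` is taken after the symmetrization, where all terms are
bounded uniformly in `τ`.

Taking `F = Q^q · conj Q^{q+1}` turns the loop equation into a bound of `E |Q|^{2q+2}` by lower
moments, with a factor `t = 1 / (m Im z)` for each power that is lost; since `|s|² ≲ 1 + |Q|`,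
this closes and gives `E |Q|^{2q+2} ≲ t^{2q+2}` (`exists_moment_mpQuad_le`).

For real `E` in the bulk, `Q` factors as `E (s - w) (s - conj w)` with `Im w = π ρ(E)`. As `s` lies
in the upper half plane, `|s - conj w|` is bounded below and `|Im s - π ρ(E)| ≲ |Q| + Im z` with no
continuity argument in `z` (`exists_abs_im_sub_le`). By Markov's inequality the deviation averaged
over a bulk interval is small with overwhelming probability at every scale `η = m^{-1+ε'}`
(`exists_measure_integral_mpDev_le`). Finally `Im s(E + i η)` is a Poisson-kernel smoothing of the
empirical measure, so comparing two scales `η₁ ≪ η₂ ≪ |J|` yields the number of points in `J`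
(`exists_abs_count_sub_lt`, `exists_bulk_law`).

Windows with `ε < 1` eventually lie in the bulk. For `ε = 1` they have length `2` and may cover the
edges; the total mass `1` of the Marchenko-Pastur law (`integral_mpDensity`) shows that few points
lie outside a large bulk interval. For `ε > 1` the event is eventually empty.
-/

open Filter Topology Function

/-! ### Slicing integrals over `Fin m → ℝ` -/

theorem integral_eq_zero_of_forall_update {m : ℕ} (i : Fin m) (f : (Fin m → ℝ) → ℂ)
    (hf : Integrable f) (h : ∀ x, ∫ t, f (update x i t) = 0) : ∫ x, f x = 0 := by
  obtain _ | n := m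
  · exact i.elim0
  have hp := (volume_preserving_piFinSuccAbove (fun _ : Fin (n + 1) => ℝ) i).symm
  rw [← hp.integral_comp' f]
  have hi := (hp.integrable_comp_emb (MeasurableEquiv.measurableEmbedding _)).2 hf
  rw [Measure.volume_eq_prod, integral_prod_symm _ (by rw [← Measure.volume_eq_prod]; exact hi)]
  have : ∀ y : Fin n → ℝ, ∫ t, f ((MeasurableEquiv.piFinSuccAbove (fun _ : Fin (n + 1) => ℝ) i).symm
      (t, y)) = 0 := fun y => by
    rw [← h (i.insertNth 0 y)]
    simp [MeasurableEquiv.piFinSuccAbove_symm_apply, Fin.insertNthEquiv, Fin.update_insertNth]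
  simp only [this, integral_zero]

/-! ### The regularized weight -/

/-- The Laguerre weight with every factor `|x_k - x_l| ^ β` replaced by the smooth
`((x_k - x_l) ^ 2 + τ) ^ (β / 2)`. Here `b` is the exponent of `∏ i, x_i`. -/
noncomputable def regWeight (m : ℕ) (β b τ : ℝ) (x : Fin m → ℝ) : ℝ :=
  open Classical in
  if ∀ i, 0 < x i then
    (∏ k, ∏ l ∈ Finset.Ioi k, ((x k - x l) ^ 2 + τ) ^ (β / 2))
      * (∏ i, x i ^ b) * Real.exp (-(β / 2) * ∑ i, x i)
  else 0

theorem regWeight_zero (m : ℕ) (β a : ℝ) (x : Fin m → ℝ) :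
    regWeight m β (a - β / 2 * ((m : ℝ) - 1) - 1) 0 x = laguerreWeight m β a x := by
  unfold regWeight laguerreWeight
  congr 1
  congr 2
  refine Finset.prod_congr rfl fun k _ => Finset.prod_congr rfl fun l _ => ?_
  rw [add_zero, ← sq_abs, ← Real.rpow_natCast, ← Real.rpow_mul (abs_nonneg _)]
  congr 1
  push_cast
  ring

theorem regWeight_nonneg {m : ℕ} {β b τ : ℝ} (hτ : 0 ≤ τ) (x : Fin m → ℝ) :
    0 ≤ regWeight m β b τ x := by
  unfold regWeight
  split_ifs with h
  · refine mul_nonneg (mul_nonneg ?_ ?_) (Real.exp_pos _).le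
    · exact Finset.prod_nonneg fun i _ => Finset.prod_nonneg fun j _ =>
        Real.rpow_nonneg (by positivity) _
    · exact Finset.prod_nonneg fun i _ => Real.rpow_nonneg (h i).le _
  · exact le_rfl

theorem measurable_regWeight (m : ℕ) (β b τ : ℝ) : Measurable (regWeight m β b τ) := by
  unfold regWeight
  refine Measurable.ite ?_ ?_ measurable_const
  · rw [Set.ofPred_forall]
    exact MeasurableSet.iInter fun i => measurableSet_lt measurable_const (measurable_pi_apply i)
  · fun_prop

theorem exists_one_add_rpow_le_exp (P c : ℝ) (hP : 0 ≤ P) (hc : 0 < c) :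
    ∃ C : ℝ, 0 < C ∧ ∀ S : ℝ, 0 ≤ S → (1 + S) ^ P ≤ C * Real.exp (c * S) := by
  set q := c / (P + 1) with hq
  have hq0 : 0 < q := by positivity
  refine ⟨(1 + 1 / q) ^ P, by positivity, fun S hS => ?_⟩
  have h1 : 1 + S ≤ (1 + 1 / q) * Real.exp (q * S) := by
    have h2 := Real.add_one_le_exp (q * S)
    have h3 : S ≤ 1 / q * Real.exp (q * S) := by
      rw [one_div, ← div_eq_inv_mul, le_div_iff₀ hq0]
      linarith
    have h4 : (1 : ℝ) ≤ Real.exp (q * S) := Real.one_le_exp (by positivity)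
    linarith
  calc (1 + S) ^ P ≤ ((1 + 1 / q) * Real.exp (q * S)) ^ P :=
        Real.rpow_le_rpow (by positivity) h1 hP
    _ = (1 + 1 / q) ^ P * Real.exp (q * S * P) := by
        rw [Real.mul_rpow (by positivity) (Real.exp_pos _).le, ← Real.exp_mul]
    _ ≤ _ := by
        have : q * P ≤ c := by
          rw [hq, div_mul_eq_mul_div, div_le_iff₀ (by positivity)]
          nlinarith
        gcongr _ * Real.exp ?_
        nlinarith

/-- One-dimensional factor of the integrable function that dominates the regularized weights. -/
noncomputable def gammaBound (β b t : ℝ) : ℝ :=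
  (Ioi (0 : ℝ)).indicator (fun t => t ^ b * Real.exp (-(β / 4) * t)) t

theorem gammaBound_nonneg (β b t : ℝ) : 0 ≤ gammaBound β b t :=
  Set.indicator_nonneg (fun t (ht : 0 < t) => by positivity) t

theorem gammaBound_of_pos (β b : ℝ) {t : ℝ} (ht : 0 < t) :
    gammaBound β b t = t ^ b * Real.exp (-(β / 4) * t) :=
  Set.indicator_of_mem (show t ∈ Ioi (0 : ℝ) from ht) _

theorem integrable_gammaBound {β b : ℝ} (hβ : 0 < β) (hb : -1 < b) :
    Integrable (gammaBound β b) := by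
  have := integrableOn_rpow_mul_exp_neg_mul_rpow (p := 1) (b := β / 4) hb one_pos (by positivity)
  simp only [Real.rpow_one] at this
  exact (integrable_indicator_iff measurableSet_Ioi).2 this

theorem integrable_prod_gammaBound (m : ℕ) {β b : ℝ} (hβ : 0 < β) (hb : -1 < b) :
    Integrable fun x : Fin m → ℝ => ∏ i, gammaBound β b (x i) :=
  Integrable.fintype_prod (f := fun _ => gammaBound β b) fun _ => integrable_gammaBound hβ hb

theorem exists_regWeight_le (m : ℕ) {β : ℝ} (b : ℝ) (hβ : 0 < β) :
    ∃ C : ℝ, 0 < C ∧ ∀ τ ∈ Icc (0 : ℝ) 1, ∀ x : Fin m → ℝ,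
      regWeight m β b τ x ≤ C * ∏ i, gammaBound β b (x i) := by
  set n : ℕ := ∑ k : Fin m, (Finset.Ioi k).card
  obtain ⟨C, hC, hC'⟩ := exists_one_add_rpow_le_exp (β * n) (β / 4) (by positivity) (by positivity)
  refine ⟨C, hC, fun τ hτ x => ?_⟩
  unfold regWeight
  split_ifs with h
  swap
  · exact mul_nonneg hC.le (Finset.prod_nonneg fun i _ => gammaBound_nonneg _ _ _)
  set S := ∑ i, x i with hS
  have hxS : ∀ i, x i ≤ S := fun i =>
    Finset.single_le_sum (f := x) (fun j _ => (h j).le) (Finset.mem_univ i)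
  have hS0 : 0 ≤ S := Finset.sum_nonneg fun i _ => (h i).le
  have h1 : ∏ k, ∏ l ∈ Finset.Ioi k, ((x k - x l) ^ 2 + τ) ^ (β / 2) ≤ (1 + S) ^ (β * n) := by
    calc _ ≤ ∏ k : Fin m, ∏ l ∈ Finset.Ioi k, (1 + S) ^ β := by
          refine Finset.prod_le_prod (fun i _ => Finset.prod_nonneg fun j _ =>
            Real.rpow_nonneg (add_nonneg (sq_nonneg _) hτ.1) _)
            fun i _ => Finset.prod_le_prod (fun j _ =>
              Real.rpow_nonneg (add_nonneg (sq_nonneg _) hτ.1) _) fun j _ => ?_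
          have h2 : (1 + S) ^ β = ((1 + S) ^ 2) ^ (β / 2) := by
            rw [← Real.rpow_natCast, ← Real.rpow_mul (by positivity)]
            congr 1
            push_cast
            ring
          rw [h2]
          refine Real.rpow_le_rpow (add_nonneg (sq_nonneg _) hτ.1) ?_ (by positivity)
          have : |x i - x j| ≤ S :=
            abs_le.2 ⟨by linarith [h i, hxS j], by linarith [h j, hxS i]⟩
          have h3 : (x i - x j) ^ 2 ≤ S ^ 2 := sq_le_sq' (neg_le_of_abs_le this) (le_of_abs_le this)
          nlinarith [hτ.2]
      _ = (1 + S) ^ (β * n) := by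
          simp only [Finset.prod_const, Finset.prod_pow_eq_pow_sum]
          rw [Real.rpow_mul (by positivity), Real.rpow_natCast]
  have h2 : ∏ i, gammaBound β b (x i) = (∏ i, x i ^ b) * Real.exp (-(β / 4) * S) := by
    rw [hS, Finset.mul_sum, Real.exp_sum, ← Finset.prod_mul_distrib]
    exact Finset.prod_congr rfl fun i _ => gammaBound_of_pos _ _ (h i)
  have hA : 0 ≤ ∏ i, x i ^ b := Finset.prod_nonneg fun i _ => Real.rpow_nonneg (h i).le _
  rw [h2]
  calc _ ≤ (C * Real.exp (β / 4 * S)) * (∏ i, x i ^ b) * Real.exp (-(β / 2) * S) := by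
        gcongr
        exact h1.trans (hC' S hS0)
    _ = _ := by
        have : Real.exp (-(β / 4) * S) = Real.exp (β / 4 * S) * Real.exp (-(β / 2) * S) := by
          rw [← Real.exp_add]; ring_nf
        rw [this]; ring

theorem tendsto_regWeight (m : ℕ) {β : ℝ} (b : ℝ) (hβ : 0 < β) (x : Fin m → ℝ) :
    Tendsto (fun τ => regWeight m β b τ x) (𝓝[>] 0) (𝓝 (regWeight m β b 0 x)) := by
  refine Tendsto.mono_left ?_ nhdsWithin_le_nhds
  unfold regWeight
  split_ifs with h
  · refine ((tendsto_finsetProd _ fun k _ => tendsto_finsetProd _ fun l _ => ?_).mul_const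
      _).mul_const _
    have : Continuous fun τ : ℝ => ((x k - x l) ^ 2 + τ) ^ (β / 2) :=
      (by fun_prop : Continuous fun τ : ℝ => (x k - x l) ^ 2 + τ).rpow_const
        fun _ => Or.inr (by positivity)
    exact this.tendsto 0
  · exact tendsto_const_nhds

theorem regWeight_zero_eq_zero {m : ℕ} {β b : ℝ} (hβ : 0 < β) {x : Fin m → ℝ} {k l : Fin m}
    (hkl : k < l) (h : x k = x l) : regWeight m β b 0 x = 0 := by
  unfold regWeight
  split_ifs
  · rw [Finset.prod_eq_zero (Finset.mem_univ k), zero_mul, zero_mul]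
    refine Finset.prod_eq_zero (Finset.mem_Ioi.2 hkl) ?_
    rw [h, sub_self, add_zero, zero_pow two_ne_zero, Real.zero_rpow (by positivity)]
  · rfl

/-- The pair-interaction part of the `i`-th logarithmic derivative of the regularized weight,
written as a sum over all pairs so that summing over `i` against a vector symmetrizes it. -/
noncomputable def pairForce {m : ℕ} (β τ : ℝ) (i : Fin m) (x : Fin m → ℝ) : ℝ :=
  ∑ k, ∑ l ∈ Finset.Ioi k, β * ((x k - x l) / ((x k - x l) ^ 2 + τ)) *
    ((Pi.single i (1 : ℝ) : Fin m → ℝ) k - (Pi.single i (1 : ℝ) : Fin m → ℝ) l)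

theorem regWeight_eq_exp {m : ℕ} (β b : ℝ) {τ : ℝ} (hτ : 0 < τ) {x : Fin m → ℝ}
    (hx : ∀ i, 0 < x i) :
    regWeight m β b τ x = Real.exp (∑ k, ∑ l ∈ Finset.Ioi k,
      Real.log ((x k - x l) ^ 2 + τ) * (β / 2) + ∑ i, Real.log (x i) * b
        + -(β / 2) * ∑ i, x i) := by
  unfold regWeight
  rw [if_pos hx, Real.exp_add, Real.exp_add, Real.exp_sum, Real.exp_sum]
  congr 2
  · refine Finset.prod_congr rfl fun k _ => ?_
    rw [Real.exp_sum]
    exact Finset.prod_congr rfl fun l _ => Real.rpow_def_of_pos (by positivity) _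
  · exact Finset.prod_congr rfl fun l _ => Real.rpow_def_of_pos (hx l) _

theorem hasDerivAt_regWeight {m : ℕ} (β b : ℝ) {τ : ℝ} (hτ : 0 < τ) {x : Fin m → ℝ}
    (hx : ∀ i, 0 < x i) (i : Fin m) :
    HasDerivAt (fun t => regWeight m β b τ (update x i t))
      (regWeight m β b τ x * (pairForce β τ i x + b / x i - β / 2)) (x i) := by
  have hk : ∀ k, HasDerivAt (fun t => update x i t k) ((Pi.single i (1 : ℝ) : Fin m → ℝ) k) (x i) :=
    fun k => hasDerivAt_pi.1 (hasDerivAt_update x i (x i)) k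
  have h1 : HasDerivAt (fun t => ∑ k, ∑ l ∈ Finset.Ioi k,
      Real.log ((update x i t k - update x i t l) ^ 2 + τ) * (β / 2))
      (pairForce β τ i x) (x i) := by
    refine HasDerivAt.fun_sum fun k _ => HasDerivAt.fun_sum fun l _ => ?_
    have h3 : (x k - x l) ^ 2 + τ ≠ 0 := by positivity
    have h2 := (((((hk k).sub (hk l)).pow 2).add_const τ).log
      (by simpa using h3)).mul_const (β / 2)
    refine h2.congr_deriv ?_
    simp only [Pi.sub_apply, Pi.pow_apply, update_eq_self]
    field_simp
    push_cast
    ring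
  have h2 : HasDerivAt (fun t => ∑ j, Real.log (update x i t j) * b) (b / x i) (x i) := by
    have := HasDerivAt.fun_sum (u := Finset.univ) fun j _ =>
      ((hk j).log (by simpa using (hx j).ne')).mul_const b
    refine this.congr_deriv ?_
    rw [Finset.sum_eq_single i]
    · simp [div_eq_inv_mul]
    · intro j _ hj
      simp [Pi.single_eq_of_ne hj]
    · simp
  have h3 : HasDerivAt (fun t => -(β / 2) * ∑ j, update x i t j) (-(β / 2)) (x i) := by
    have := (HasDerivAt.fun_sum (u := Finset.univ) fun j _ => hk j).const_mul (-(β / 2))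
    refine this.congr_deriv ?_
    simp
  have h4 := ((h1.add h2).add h3).exp
  have h5 : (fun t => regWeight m β b τ (update x i t)) =ᶠ[𝓝 (x i)] fun t =>
      Real.exp (∑ k, ∑ l ∈ Finset.Ioi k,
      Real.log ((update x i t k - update x i t l) ^ 2 + τ) * (β / 2)
        + ∑ j, Real.log (update x i t j) * b + -(β / 2) * ∑ j, update x i t j) := by
    filter_upwards [lt_mem_nhds (hx i)] with t ht
    refine regWeight_eq_exp β b hτ fun j => ?_
    rcases eq_or_ne j i with rfl | hj
    · simpa using ht
    · simpa [update_of_ne hj] using hx j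
  refine (h4.congr_of_eventuallyEq h5).congr_deriv ?_
  rw [regWeight_eq_exp β b hτ hx]
  simp only [Pi.add_apply, update_eq_self]
  ring

/-! ### Integration by parts against the regularized weight -/

theorem sub_ne_zero_of_im_pos {Z : ℂ} (hZ : 0 < Z.im) (t : ℝ) : (t : ℂ) - Z ≠ 0 := fun h => by
  have := congrArg Complex.im h
  simp at this
  exact hZ.ne' this

theorem norm_resolvent_le {Z : ℂ} (hZ : 0 < Z.im) (t : ℝ) : ‖((t : ℂ) - Z)⁻¹‖ ≤ 1 / Z.im := by
  rw [norm_inv, one_div]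
  refine inv_anti₀ hZ ?_
  have := Complex.abs_im_le_norm ((t : ℂ) - Z)
  simpa [abs_of_pos hZ] using this

theorem mul_resolvent_eq {Z : ℂ} (hZ : 0 < Z.im) (t : ℝ) :
    (t : ℂ) * ((t : ℂ) - Z)⁻¹ = 1 + Z * ((t : ℂ) - Z)⁻¹ := by
  have := sub_ne_zero_of_im_pos hZ t
  field_simp
  ring

theorem norm_mul_resolvent_le {Z : ℂ} (hZ : 0 < Z.im) (t : ℝ) :
    ‖(t : ℂ) * ((t : ℂ) - Z)⁻¹‖ ≤ 1 + ‖Z‖ / Z.im := by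
  rw [mul_resolvent_eq hZ]
  refine (norm_add_le _ _).trans ?_
  rw [norm_one, norm_mul, div_eq_mul_one_div]
  gcongr
  exact norm_resolvent_le hZ t

theorem continuous_resolvent {Z : ℂ} (hZ : 0 < Z.im) :
    Continuous fun t : ℝ => ((t : ℂ) - Z)⁻¹ :=
  Continuous.inv₀ (by fun_prop) (sub_ne_zero_of_im_pos hZ)

theorem hasDerivAt_resolvent {Z : ℂ} (hZ : 0 < Z.im) (t : ℝ) :
    HasDerivAt (fun t : ℝ => ((t : ℂ) - Z)⁻¹) (-(((t : ℂ) - Z)⁻¹) ^ 2) t := by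
  have h := (((hasDerivAt_id t).ofReal_comp).sub_const Z).inv (sub_ne_zero_of_im_pos hZ t)
  refine h.congr_deriv ?_
  have := sub_ne_zero_of_im_pos hZ t
  simp only [id]
  field_simp
  simp

theorem hasDerivAt_mul_resolvent {Z : ℂ} (hZ : 0 < Z.im) (t : ℝ) :
    HasDerivAt (fun t : ℝ => (t : ℂ) * ((t : ℂ) - Z)⁻¹) (-Z * (((t : ℂ) - Z)⁻¹) ^ 2) t := by
  have h := ((hasDerivAt_resolvent hZ t).const_mul Z).const_add 1
  refine (h.congr_of_eventuallyEq (Eventually.of_forall fun s => ?_)).congr_deriv ?_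
  · exact mul_resolvent_eq hZ s
  · ring

theorem measurable_pairForce {m : ℕ} (β τ : ℝ) (i : Fin m) : Measurable (pairForce β τ i) := by
  unfold pairForce
  fun_prop

theorem exists_abs_pairForce_le {m : ℕ} (β : ℝ) {τ : ℝ} (hτ : 0 < τ) (i : Fin m) :
    ∃ K : ℝ, ∀ x, |pairForce β τ i x| ≤ K := by
  refine ⟨∑ k : Fin m, ∑ l ∈ Finset.Ioi k, |β| * (1 / τ + 1) * 2, fun x => ?_⟩
  refine (Finset.abs_sum_le_sum_abs _ _).trans (Finset.sum_le_sum fun k _ =>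
    (Finset.abs_sum_le_sum_abs _ _).trans (Finset.sum_le_sum fun l _ => ?_))
  have h1 : |(x k - x l) / ((x k - x l) ^ 2 + τ)| ≤ 1 / τ + 1 := by
    set u := x k - x l
    have hpos : 0 < u ^ 2 + τ := by positivity
    rw [abs_div, abs_of_pos hpos, div_le_iff₀ hpos]
    have h2 : 1 ≤ 1 / τ * (u ^ 2 + τ) := by
      rw [one_div, ← div_eq_inv_mul, le_div_iff₀ hτ]
      nlinarith [sq_nonneg u]
    nlinarith [sq_abs u, sq_nonneg (|u| - 1), abs_nonneg u]
  have h2 : ∀ k : Fin m, |(Pi.single i (1 : ℝ) : Fin m → ℝ) k| ≤ 1 := fun k => by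
    rcases eq_or_ne k i with rfl | hk
    · simp
    · simp [Pi.single_eq_of_ne hk]
  have h3 : |(Pi.single i (1 : ℝ) : Fin m → ℝ) k - (Pi.single i (1 : ℝ) : Fin m → ℝ) l| ≤ 2 :=
    (abs_sub _ _).trans (by linarith [h2 k, h2 l])
  rw [abs_mul, abs_mul]
  gcongr

/-- Test functions of the loop equation: bounded and continuous, with bounded continuous partial
derivatives `F' i`. -/
structure IsTestFunction {m : ℕ} (F : (Fin m → ℝ) → ℂ) (F' : Fin m → (Fin m → ℝ) → ℂ) : Prop where
  continuous : Continuous F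
  continuous_deriv : ∀ i, Continuous (F' i)
  bounded : ∃ K, ∀ x, ‖F x‖ ≤ K
  bounded_deriv : ∃ K, ∀ i x, ‖F' i x‖ ≤ K
  hasDerivAt : ∀ i x, HasDerivAt (fun t => F (update x i t)) (F' i x) (x i)

/-- The `i`-th partial derivative of `w · x_i / (x_i - Z) · F`, where `w` is the regularized
weight, with the factor `w` taken out. -/
noncomputable def ibpFactor {m : ℕ} (β b τ : ℝ) (Z : ℂ) (F : (Fin m → ℝ) → ℂ)
    (F' : Fin m → (Fin m → ℝ) → ℂ) (i : Fin m) (x : Fin m → ℝ) : ℂ :=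
  ((pairForce β τ i x : ℂ) * (x i * ((x i : ℂ) - Z)⁻¹) + b * ((x i : ℂ) - Z)⁻¹
    - β / 2 * (x i * ((x i : ℂ) - Z)⁻¹) - Z * (((x i : ℂ) - Z)⁻¹) ^ 2) * F x
    + x i * ((x i : ℂ) - Z)⁻¹ * F' i x

section

variable {m : ℕ} {β b τ : ℝ} {Z : ℂ} {F : (Fin m → ℝ) → ℂ} {F' : Fin m → (Fin m → ℝ) → ℂ}

theorem measurable_ibpFactor (hF : IsTestFunction F F') (i : Fin m) :
    Measurable (ibpFactor β b τ Z F F' i) := by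
  have h1 := hF.continuous.measurable
  have h2 := (hF.continuous_deriv i).measurable
  have h3 := measurable_pairForce β τ i
  unfold ibpFactor
  fun_prop

theorem exists_norm_ibpFactor_le (hτ : 0 < τ) (hZ : 0 < Z.im) (hF : IsTestFunction F F')
    (i : Fin m) : ∃ K : ℝ, ∀ x, ‖ibpFactor β b τ Z F F' i x‖ ≤ K := by
  obtain ⟨K1, hK1⟩ := exists_abs_pairForce_le β hτ i
  obtain ⟨K2, hK2⟩ := hF.bounded
  obtain ⟨K3, hK3⟩ := hF.bounded_deriv
  set G := 1 + ‖Z‖ / Z.im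
  set R := 1 / Z.im
  refine ⟨(K1 * G + |b| * R + |β / 2| * G + ‖Z‖ * R ^ 2) * K2 + G * K3, fun x => ?_⟩
  have hG : ‖(x i : ℂ) * ((x i : ℂ) - Z)⁻¹‖ ≤ G := norm_mul_resolvent_le hZ _
  have hR : ‖((x i : ℂ) - Z)⁻¹‖ ≤ R := norm_resolvent_le hZ _
  have hK1' : ‖(pairForce β τ i x : ℂ)‖ ≤ K1 := by simpa using hK1 x
  have hb : ‖(b : ℂ)‖ = |b| := by simp
  have hβ : ‖(β / 2 : ℂ)‖ = |β / 2| := by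
    rw [← Complex.ofReal_ofNat, ← Complex.ofReal_div, Complex.norm_real, Real.norm_eq_abs]
  unfold ibpFactor
  have k1 : 0 ≤ K1 := (norm_nonneg _).trans hK1'
  have k2 : 0 ≤ G := (norm_nonneg _).trans hG
  refine (norm_add_le _ _).trans (add_le_add ?_ ?_)
  · rw [norm_mul]
    have : 0 ≤ R := (norm_nonneg _).trans hR
    refine mul_le_mul ?_ (hK2 x) (norm_nonneg _) (by positivity)
    refine (norm_sub_le _ _).trans (add_le_add ((norm_sub_le _ _).trans (add_le_add
      ((norm_add_le _ _).trans (add_le_add ?_ ?_)) ?_)) ?_)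
    · rw [norm_mul]; gcongr
    · rw [norm_mul, hb]; gcongr
    · rw [norm_mul, hβ]; gcongr
    · rw [norm_mul, norm_pow]; gcongr
  · rw [norm_mul]
    have := hK3 i x
    gcongr

theorem exists_norm_weighted_le (hβ : 0 < β) (hτ : τ ∈ Icc (0 : ℝ) 1) {f : (Fin m → ℝ) → ℂ}
    (hf : ∃ K : ℝ, ∀ x, ‖f x‖ ≤ K) :
    ∃ K : ℝ, 0 ≤ K ∧ ∀ x, ‖(regWeight m β b τ x : ℂ) * f x‖ ≤ K * ∏ i, gammaBound β b (x i) := by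
  obtain ⟨C, hC, hC'⟩ := exists_regWeight_le m b hβ
  obtain ⟨K, hK⟩ := hf
  have hK0 : 0 ≤ K := (norm_nonneg _).trans (hK 0)
  refine ⟨C * K, by positivity, fun x => ?_⟩
  rw [norm_mul, Complex.norm_real, Real.norm_of_nonneg (regWeight_nonneg hτ.1 x)]
  calc _ ≤ (C * ∏ i, gammaBound β b (x i)) * K :=
        mul_le_mul (hC' τ hτ x) (hK x) (norm_nonneg _) (mul_nonneg hC.le
          (Finset.prod_nonneg fun i _ => gammaBound_nonneg _ _ _))
    _ = _ := by ring

theorem integrable_weighted (hβ : 0 < β) (hb : -1 < b) (hτ : τ ∈ Icc (0 : ℝ) 1)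
    {f : (Fin m → ℝ) → ℂ} (hfm : Measurable f) (hf : ∃ K : ℝ, ∀ x, ‖f x‖ ≤ K) :
    Integrable fun x => (regWeight m β b τ x : ℂ) * f x := by
  obtain ⟨K, -, hK⟩ := exists_norm_weighted_le (b := b) hβ hτ hf
  refine ((integrable_prod_gammaBound m hβ hb).const_mul K).mono' ?_ (Eventually.of_forall hK)
  exact ((Complex.measurable_ofReal.comp (measurable_regWeight m β b τ)).mul hfm).aestronglyMeasurable

theorem prod_gammaBound_update (x : Fin m → ℝ) (i : Fin m) (t : ℝ) :
    ∏ j, gammaBound β b (update x i t j)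
      = (∏ j ∈ {i}ᶜ, gammaBound β b (x j)) * gammaBound β b t := by
  rw [Fintype.prod_eq_mul_prod_compl i, mul_comm, update_self]
  congr 1
  refine Finset.prod_congr rfl fun j hj => ?_
  rw [update_of_ne (by simpa using hj)]

theorem integral_ibp_slice (hβ : 0 < β) (hb : -1 < b) (hτ : τ ∈ Ioc (0 : ℝ) 1) (hZ : 0 < Z.im)
    (hF : IsTestFunction F F') (i : Fin m) (x : Fin m → ℝ) :
    ∫ t, (regWeight m β b τ (update x i t) : ℂ) * ibpFactor β b τ Z F F' i (update x i t) = 0 := by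
  have hτ' : τ ∈ Icc (0 : ℝ) 1 := ⟨hτ.1.le, hτ.2⟩
  by_cases hx : ∀ j ≠ i, 0 < x j
  swap
  · push Not at hx
    obtain ⟨j, hj, hxj⟩ := hx
    have : ∀ t, regWeight m β b τ (update x i t) = 0 := fun t => by
      unfold regWeight
      rw [if_neg]
      intro h
      have := h j
      rw [update_of_ne hj] at this
      exact this.not_ge hxj
    simp [this]
  have hpos : ∀ t, 0 < t → ∀ j, 0 < update x i t j := fun t ht j => by
    rcases eq_or_ne j i with rfl | hj
    · simpa using ht
    · simpa [update_of_ne hj] using hx j hj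
  have hneg : ∀ t ≤ 0, regWeight m β b τ (update x i t) = 0 := fun t ht => by
    unfold regWeight
    rw [if_neg]
    intro h
    have := h i
    rw [update_self] at this
    exact this.not_ge ht
  obtain ⟨K1, hK10, hK1⟩ := exists_norm_weighted_le (b := b) hβ hτ'
    (exists_norm_ibpFactor_le (β := β) (b := b) hτ.1 hZ hF i)
  obtain ⟨K2, hK20, hK2⟩ := exists_norm_weighted_le (b := b) hβ hτ' hF.bounded
  set P := ∏ j ∈ {i}ᶜ, gammaBound β b (x j) with hP
  have hP0 : 0 ≤ P := Finset.prod_nonneg fun i _ => gammaBound_nonneg _ _ _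
  set g : ℝ → ℂ := fun t =>
    (regWeight m β b τ (update x i t) : ℂ) * ibpFactor β b τ Z F F' i (update x i t) with hg
  set φ : ℝ → ℂ := fun t => (t : ℂ) * ((t : ℂ) - Z)⁻¹ *
    ((regWeight m β b τ (update x i t) : ℂ) * F (update x i t)) with hφ
  have hg0 : ∫ t, g t = ∫ t in Ioi (0 : ℝ), g t := by
    rw [← integral_indicator measurableSet_Ioi]
    congr 1
    ext t
    by_cases ht : t ∈ Ioi (0 : ℝ)
    · rw [indicator_of_mem ht]
    · rw [indicator_of_notMem ht, hg]
      simp [hneg t (not_lt.1 ht)]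
  have hφ1 : ∀ t, ‖φ t‖ ≤ ‖(t : ℂ) * ((t : ℂ) - Z)⁻¹‖ * (K2 * P * gammaBound β b t) := fun t => by
    rw [hφ, norm_mul]
    have := hK2 (update x i t)
    rw [prod_gammaBound_update] at this
    gcongr
    rw [mul_assoc]
    exact this
  have hg1 : ∀ t, ‖g t‖ ≤ K1 * P * gammaBound β b t := fun t => by
    have := hK1 (update x i t)
    rwa [prod_gammaBound_update, ← mul_assoc] at this
  change ∫ t, g t = 0
  have hφ0 : φ 0 = 0 := by simp [hφ]
  rw [hg0, integral_Ioi_of_hasDerivAt_of_tendsto (f := φ) (m := 0) (f' := g), hφ0, sub_zero]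
  · -- near `0` the primitive is `O(t ^ (b + 1))`
    refine ContinuousAt.continuousWithinAt ?_
    rw [ContinuousAt, hφ0]
    have hlim : Tendsto (fun t : ℝ => 1 / Z.im * (K2 * P) * |t| ^ (b + 1)) (𝓝 0) (𝓝 0) := by
      have h0 : Continuous fun t : ℝ => 1 / Z.im * (K2 * P) * |t| ^ (b + 1) :=
        continuous_const.mul (continuous_abs.rpow_const fun t => Or.inr (by linarith))
      have := h0.tendsto 0
      rwa [abs_zero, Real.zero_rpow (by linarith), mul_zero] at this
    refine squeeze_zero_norm (fun t => ?_) hlim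
    rcases le_or_gt t 0 with ht | ht
    · rw [hφ]
      simp only [hneg t ht]
      simp
      positivity
    · refine (hφ1 t).trans ?_
      rw [norm_mul, gammaBound_of_pos _ _ ht, Complex.norm_real, Real.norm_eq_abs, abs_of_pos ht,
        Real.rpow_add ht, Real.rpow_one]
      have he : Real.exp (-(β / 4) * t) ≤ 1 := Real.exp_le_one_iff.2 (by nlinarith)
      calc t * ‖((t : ℂ) - Z)⁻¹‖ * (K2 * P * (t ^ b * Real.exp (-(β / 4) * t)))
          ≤ t * (1 / Z.im) * (K2 * P * (t ^ b * 1)) := by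
            gcongr
            exact norm_resolvent_le hZ t
        _ = _ := by ring
  · intro t ht
    have ht' : 0 < t := ht
    have h1 := hasDerivAt_mul_resolvent hZ t
    have h2 := hasDerivAt_regWeight β b hτ.1 (hpos t ht') i
    have h3 := hF.hasDerivAt i (update x i t)
    simp only [update_idem, update_self] at h2 h3
    refine (h1.mul (h2.ofReal_comp.mul h3)).congr_deriv ?_
    have htc : (t : ℂ) ≠ 0 := by exact_mod_cast ht'.ne'
    have hbt : (b : ℂ) * ((t : ℂ) - Z)⁻¹ = b / t * (t * ((t : ℂ) - Z)⁻¹) := by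
      rw [← mul_assoc, div_mul_cancel₀ _ htc]
    simp only [hg, ibpFactor, update_self, hbt, Pi.mul_apply]
    push_cast
    ring
  · refine Integrable.mono' (((integrable_gammaBound hβ hb).const_mul (K1 * P)).integrableOn) ?_
      (Eventually.of_forall hg1)
    have : Measurable g := by
      refine Measurable.mul (Complex.measurable_ofReal.comp
        ((measurable_regWeight m β b τ).comp (measurable_update x)))
        ((measurable_ibpFactor hF i).comp (measurable_update x))
    exact this.aestronglyMeasurable
  · have h0 := tendsto_rpow_mul_exp_neg_mul_atTop_nhds_zero b (β / 4) (by positivity)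
    have h1 := h0.const_mul ((1 + ‖Z‖ / Z.im) * (K2 * P))
    rw [mul_zero] at h1
    refine squeeze_zero_norm' ?_ h1
    filter_upwards [eventually_gt_atTop 0] with t ht
    refine (hφ1 t).trans ?_
    rw [gammaBound_of_pos _ _ ht, mul_assoc (1 + ‖Z‖ / Z.im)]
    gcongr
    exact norm_mul_resolvent_le hZ t

theorem integral_ibp (hβ : 0 < β) (hb : -1 < b) (hτ : τ ∈ Ioc (0 : ℝ) 1) (hZ : 0 < Z.im)
    (hF : IsTestFunction F F') (i : Fin m) :
    ∫ x, (regWeight m β b τ x : ℂ) * ibpFactor β b τ Z F F' i x = 0 :=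
  integral_eq_zero_of_forall_update i _
    (integrable_weighted hβ hb ⟨hτ.1.le, hτ.2⟩ (measurable_ibpFactor hF i)
      (exists_norm_ibpFactor_le hτ.1 hZ hF i))
    (integral_ibp_slice hβ hb hτ hZ hF i)

end

/-! ### The loop equation -/

section

variable {m : ℕ} {β b a τ : ℝ} {Z : ℂ} {F : (Fin m → ℝ) → ℂ} {F' : Fin m → (Fin m → ℝ) → ℂ}

/-- The resolvent trace `∑ i, 1 / (x_i - Z)`. -/
noncomputable def resolventTrace (Z : ℂ) (x : Fin m → ℝ) : ℂ := ∑ i, ((x i : ℂ) - Z)⁻¹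

/-- The trace `∑ i, 1 / (x_i - Z) ^ 2` of the squared resolvent. -/
noncomputable def resolventSqTrace (Z : ℂ) (x : Fin m → ℝ) : ℂ := ∑ i, (((x i : ℂ) - Z)⁻¹) ^ 2

/-- The symmetrized pair interaction `∑_{k < l} u² / (u² + τ) · 1 / ((x_k - Z) (x_l - Z))`,
`u = x_k - x_l`, which is bounded uniformly in `τ`. -/
noncomputable def regPairSum (τ : ℝ) (Z : ℂ) (x : Fin m → ℝ) : ℂ :=
  ∑ k, ∑ l ∈ Finset.Ioi k, (((x k - x l) ^ 2 / ((x k - x l) ^ 2 + τ) : ℝ) : ℂ) *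
    (((x k : ℂ) - Z)⁻¹ * ((x l : ℂ) - Z)⁻¹)

/-- The loop-equation integrand, as a function of the value `p` of the pair interaction. -/
noncomputable def loopIntegrand (β b : ℝ) (Z : ℂ) (F : (Fin m → ℝ) → ℂ)
    (F' : Fin m → (Fin m → ℝ) → ℂ) (p : ℂ) (x : Fin m → ℝ) : ℂ :=
  (-(β * Z) * p + b * resolventTrace Z x - β / 2 * (m + Z * resolventTrace Z x)
      - Z * resolventSqTrace Z x) * F x
    + ∑ i, x i * ((x i : ℂ) - Z)⁻¹ * F' i x

theorem sum_pairForce_mul (c : Fin m → ℂ) (x : Fin m → ℝ) :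
    ∑ i, (pairForce β τ i x : ℂ) * c i = ∑ k, ∑ l ∈ Finset.Ioi k,
      (β : ℂ) * (((x k - x l) / ((x k - x l) ^ 2 + τ) : ℝ) : ℂ) * (c k - c l) := by
  have h : ∀ k : Fin m, ∑ i, (((Pi.single i (1 : ℝ) : Fin m → ℝ) k : ℝ) : ℂ) * c i = c k :=
    fun k => by
    rw [Finset.sum_eq_single k]
    · simp
    · intro i _ hi
      simp [Pi.single_eq_of_ne hi.symm]
    · simp
  simp only [pairForce, Complex.ofReal_sum, Finset.sum_mul]
  rw [Finset.sum_comm]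
  refine Finset.sum_congr rfl fun k _ => ?_
  rw [Finset.sum_comm]
  refine Finset.sum_congr rfl fun l _ => ?_
  rw [← h k, ← h l, ← Finset.sum_sub_distrib, Finset.mul_sum]
  refine Finset.sum_congr rfl fun i _ => ?_
  push_cast
  ring

theorem sum_ibpFactor (hZ : 0 < Z.im) (x : Fin m → ℝ) :
    ∑ i, ibpFactor β b τ Z F F' i x = loopIntegrand β b Z F F' (regPairSum τ Z x) x := by
  have h1 : ∑ i, (pairForce β τ i x : ℂ) * (x i * ((x i : ℂ) - Z)⁻¹)
      = -(β * Z) * regPairSum τ Z x := by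
    rw [sum_pairForce_mul, regPairSum, Finset.mul_sum]
    refine Finset.sum_congr rfl fun k _ => ?_
    rw [Finset.mul_sum]
    refine Finset.sum_congr rfl fun l _ => ?_
    have hk := sub_ne_zero_of_im_pos hZ (x k)
    have hl := sub_ne_zero_of_im_pos hZ (x l)
    have : (x k : ℂ) * ((x k : ℂ) - Z)⁻¹ - x l * ((x l : ℂ) - Z)⁻¹
        = -Z * (x k - x l) * (((x k : ℂ) - Z)⁻¹ * ((x l : ℂ) - Z)⁻¹) := by
      field_simp
      ring
    rw [this]
    push_cast
    ring
  have h2 : ∑ i, (x i : ℂ) * ((x i : ℂ) - Z)⁻¹ = m + Z * resolventTrace Z x := by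
    simp only [mul_resolvent_eq hZ, Finset.sum_add_distrib, ← Finset.mul_sum, resolventTrace]
    simp
  unfold ibpFactor loopIntegrand
  rw [Finset.sum_add_distrib, ← Finset.sum_mul]
  congr 2
  rw [Finset.sum_sub_distrib, Finset.sum_sub_distrib, Finset.sum_add_distrib, h1,
    ← Finset.mul_sum, ← Finset.mul_sum, ← Finset.mul_sum, h2]
  rfl

theorem two_mul_sum_pairs (r : Fin m → ℂ) :
    2 * ∑ k, ∑ l ∈ Finset.Ioi k, r k * r l = (∑ i, r i) ^ 2 - ∑ i, r i ^ 2 := by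
  have h := Finset.sum_sum_Ioi_add_eq_sum_sum_off_diag fun k l => r k * r l
  have h1 : ∑ i, ∑ j ∈ Finset.Ioi i, (r j * r i + r i * r j)
      = 2 * ∑ k, ∑ l ∈ Finset.Ioi k, r k * r l := by
    simp only [Finset.mul_sum]
    exact Finset.sum_congr rfl fun k _ => Finset.sum_congr rfl fun l _ => by ring
  rw [← h1, h, sq, Finset.sum_mul_sum, ← Finset.sum_sub_distrib]
  refine Finset.sum_congr rfl fun i _ => ?_
  rw [Fintype.sum_eq_add_sum_compl i (fun j => r i * r j), sq, add_sub_cancel_left]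
  exact Finset.sum_congr rfl fun j _ => mul_comm _ _

theorem continuous_resolventTrace (hZ : 0 < Z.im) :
    Continuous (resolventTrace Z : (Fin m → ℝ) → ℂ) :=
  continuous_finsetSum _ fun i _ => (continuous_resolvent hZ).comp (continuous_apply i)

theorem continuous_resolventSqTrace (hZ : 0 < Z.im) :
    Continuous (resolventSqTrace Z : (Fin m → ℝ) → ℂ) :=
  continuous_finsetSum _ fun i _ => ((continuous_resolvent hZ).comp (continuous_apply i)).pow 2

theorem norm_resolventTrace_le (hZ : 0 < Z.im) (x : Fin m → ℝ) :
    ‖resolventTrace Z x‖ ≤ m * (1 / Z.im) := by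
  refine (norm_sum_le _ _).trans ?_
  refine (Finset.sum_le_sum fun i _ => norm_resolvent_le hZ (x i)).trans ?_
  simp

theorem norm_resolventSqTrace_le (hZ : 0 < Z.im) (x : Fin m → ℝ) :
    ‖resolventSqTrace Z x‖ ≤ m * (1 / Z.im) ^ 2 := by
  refine (norm_sum_le _ _).trans ?_
  refine (Finset.sum_le_sum fun i _ => ((norm_pow _ 2).trans_le
    (pow_le_pow_left₀ (norm_nonneg _) (norm_resolvent_le hZ (x i)) 2))).trans ?_
  simp

theorem norm_regPairSum_le (hτ : 0 ≤ τ) (hZ : 0 < Z.im) (x : Fin m → ℝ) :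
    ‖regPairSum τ Z x‖ ≤ ∑ k : Fin m, ∑ _l ∈ Finset.Ioi k, (1 / Z.im) ^ 2 := by
  refine (norm_sum_le _ _).trans (Finset.sum_le_sum fun k _ => (norm_sum_le _ _).trans
    (Finset.sum_le_sum fun l _ => ?_))
  rw [norm_mul, norm_mul, Complex.norm_real, Real.norm_of_nonneg (by positivity)]
  calc _ ≤ 1 * (1 / Z.im * (1 / Z.im)) := by
        refine mul_le_mul ?_ ?_ (by positivity) zero_le_one
        · exact div_le_one_of_le₀ (by linarith) (by positivity)
        · exact mul_le_mul (norm_resolvent_le hZ _) (norm_resolvent_le hZ _) (norm_nonneg _)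
            (by positivity)
    _ = _ := by ring

theorem exists_norm_loopIntegrand_le (β b : ℝ) (hZ : 0 < Z.im) (hF : IsTestFunction F F') (P : ℝ) :
    ∃ K : ℝ, ∀ p : ℂ, ‖p‖ ≤ P → ∀ x, ‖loopIntegrand β b Z F F' p x‖ ≤ K := by
  obtain ⟨K2, hK2⟩ := hF.bounded
  obtain ⟨K3, hK3⟩ := hF.bounded_deriv
  have k2 : 0 ≤ K2 := (norm_nonneg _).trans (hK2 0)
  set T := m * (1 / Z.im)
  set T2 := m * (1 / Z.im) ^ 2
  refine ⟨(‖(β * Z : ℂ)‖ * P + ‖(b : ℂ)‖ * T + ‖(β / 2 : ℂ)‖ * (m + ‖Z‖ * T) + ‖Z‖ * T2) * K2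
    + ∑ _i : Fin m, (1 + ‖Z‖ / Z.im) * K3, fun p hp x => ?_⟩
  have hP : 0 ≤ P := (norm_nonneg _).trans hp
  have h1 : ‖resolventTrace Z x‖ ≤ T := norm_resolventTrace_le hZ x
  have h2 : ‖resolventSqTrace Z x‖ ≤ T2 := norm_resolventSqTrace_le hZ x
  have hT : 0 ≤ T := (norm_nonneg _).trans h1
  have hT2 : 0 ≤ T2 := (norm_nonneg _).trans h2
  unfold loopIntegrand
  refine (norm_add_le _ _).trans (add_le_add ?_ ((norm_sum_le _ _).trans
    (Finset.sum_le_sum fun i _ => ?_)))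
  · rw [norm_mul]
    refine mul_le_mul ?_ (hK2 x) (norm_nonneg _) (by positivity)
    refine (norm_sub_le _ _).trans (add_le_add ((norm_sub_le _ _).trans (add_le_add
      ((norm_add_le _ _).trans (add_le_add ?_ ?_)) ?_)) ?_)
    · rw [norm_mul, norm_neg]; gcongr
    · rw [norm_mul]; gcongr
    · rw [norm_mul]
      gcongr
      refine (norm_add_le _ _).trans ?_
      rw [norm_mul, Complex.norm_natCast]
      gcongr
    · rw [norm_mul]; gcongr
  · rw [norm_mul]
    exact mul_le_mul (norm_mul_resolvent_le hZ _) (hK3 i x) (norm_nonneg _)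
      ((norm_nonneg _).trans (norm_mul_resolvent_le hZ (x i)))

theorem measurable_loopIntegrand (hZ : 0 < Z.im) (hF : IsTestFunction F F')
    {p : (Fin m → ℝ) → ℂ} (hp : Measurable p) :
    Measurable fun x => loopIntegrand β b Z F F' (p x) x := by
  have h1 := hF.continuous.measurable
  have h2 := fun i => (hF.continuous_deriv i).measurable
  have h3 := (continuous_resolventTrace (m := m) hZ).measurable
  have h4 := (continuous_resolventSqTrace (m := m) hZ).measurable
  unfold loopIntegrand
  fun_prop

theorem integral_regWeight_loop (hβ : 0 < β) (hb : -1 < b) (hτ : τ ∈ Ioc (0 : ℝ) 1)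
    (hZ : 0 < Z.im) (hF : IsTestFunction F F') :
    ∫ x, (regWeight m β b τ x : ℂ) * loopIntegrand β b Z F F' (regPairSum τ Z x) x = 0 := by
  simp only [← sum_ibpFactor hZ, Finset.mul_sum]
  rw [integral_finsetSum]
  · exact Finset.sum_eq_zero fun i _ => integral_ibp hβ hb hτ hZ hF i
  · exact fun i _ => integrable_weighted hβ hb ⟨hτ.1.le, hτ.2⟩ (measurable_ibpFactor hF i)
      (exists_norm_ibpFactor_le hτ.1 hZ hF i)

/-- Loop equation for the unnormalized weight: the regularization is removed by dominated
convergence, the limit of the pair interaction being read off from `two_mul_sum_pairs`. On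
configurations with a coincidence, where that limit fails, the weight itself tends to `0`. -/
theorem integral_regWeight_zero_loop (hβ : 0 < β) (hb : -1 < b) (hZ : 0 < Z.im)
    (hF : IsTestFunction F F') :
    ∫ x, (regWeight m β b 0 x : ℂ) * loopIntegrand β b Z F F'
      ((resolventTrace Z x ^ 2 - resolventSqTrace Z x) / 2) x = 0 := by
  obtain ⟨C, hC, hC'⟩ := exists_regWeight_le m b hβ
  obtain ⟨K, hK⟩ := exists_norm_loopIntegrand_le β b hZ hF
    (∑ k : Fin m, ∑ _l ∈ Finset.Ioi k, (1 / Z.im) ^ 2)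
  have hK0 : 0 ≤ K := (norm_nonneg _).trans (hK 0 (by simp; positivity) 0)
  have hτev : ∀ᶠ τ : ℝ in 𝓝[>] 0, τ ∈ Ioc (0 : ℝ) 1 := Ioc_mem_nhdsGT one_pos
  have hmp : ∀ τ : ℝ, Measurable (regPairSum τ Z : (Fin m → ℝ) → ℂ) := fun τ => by
    unfold regPairSum
    fun_prop
  have hlim : Tendsto (fun τ => ∫ x, (regWeight m β b τ x : ℂ) *
      loopIntegrand β b Z F F' (regPairSum τ Z x) x) (𝓝[>] 0)
      (𝓝 (∫ x, (regWeight m β b 0 x : ℂ) * loopIntegrand β b Z F F'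
        ((resolventTrace Z x ^ 2 - resolventSqTrace Z x) / 2) x)) := by
    refine tendsto_integral_filter_of_dominated_convergence
      (fun x => C * K * ∏ i, gammaBound β b (x i)) ?_ ?_ ?_ ?_
    · exact Eventually.of_forall fun τ => ((Complex.measurable_ofReal.comp
        (measurable_regWeight m β b τ)).mul
          (measurable_loopIntegrand hZ hF (hmp τ))).aestronglyMeasurable
    · filter_upwards [hτev] with τ hτ
      refine Eventually.of_forall fun x => ?_
      rw [norm_mul, Complex.norm_real, Real.norm_of_nonneg (regWeight_nonneg hτ.1.le x)]
      calc _ ≤ (C * ∏ i, gammaBound β b (x i)) * K :=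
            mul_le_mul (hC' τ ⟨hτ.1.le, hτ.2⟩ x) (hK _ (norm_regPairSum_le hτ.1.le hZ x) x)
              (norm_nonneg _)
              (mul_nonneg hC.le (Finset.prod_nonneg fun i _ => gammaBound_nonneg _ _ _))
        _ = _ := by ring
    · exact (integrable_prod_gammaBound m hβ hb).const_mul _
    · refine Eventually.of_forall fun x => ?_
      have hw := (Complex.continuous_ofReal.tendsto _).comp (tendsto_regWeight m b hβ x)
      by_cases hx : ∃ k l : Fin m, k < l ∧ x k = x l
      · obtain ⟨k, l, hkl, hxkl⟩ := hx
        rw [regWeight_zero_eq_zero hβ hkl hxkl] at hw ⊢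
        rw [Complex.ofReal_zero, zero_mul]
        rw [Complex.ofReal_zero] at hw
        refine squeeze_zero_norm' (a := fun τ => ‖(regWeight m β b τ x : ℂ)‖ * K) ?_ ?_
        · filter_upwards [hτev] with τ hτ
          rw [norm_mul]
          gcongr
          exact hK _ (norm_regPairSum_le hτ.1.le hZ x) x
        · simpa using hw.norm.mul_const K
      · push Not at hx
        refine hw.mul ?_
        have hp : Tendsto (fun τ => regPairSum τ Z x) (𝓝[>] 0)
            (𝓝 ((resolventTrace Z x ^ 2 - resolventSqTrace Z x) / 2)) := by
          have h2 := two_mul_sum_pairs fun i => ((x i : ℂ) - Z)⁻¹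
          have h3 : (resolventTrace Z x ^ 2 - resolventSqTrace Z x) / 2
              = ∑ k, ∑ l ∈ Finset.Ioi k, ((x k : ℂ) - Z)⁻¹ * ((x l : ℂ) - Z)⁻¹ := by
            rw [resolventTrace, resolventSqTrace, ← h2]
            ring
          rw [h3]
          refine tendsto_finsetSum _ fun k _ => tendsto_finsetSum _ fun l hl => ?_
          have hne : x k - x l ≠ 0 := sub_ne_zero.2 (hx k l (Finset.mem_Ioi.1 hl))
          have h4 : Tendsto (fun τ : ℝ => (x k - x l) ^ 2 / ((x k - x l) ^ 2 + τ)) (𝓝[>] 0)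
              (𝓝 1) := by
            have : ContinuousAt (fun τ : ℝ => (x k - x l) ^ 2 / ((x k - x l) ^ 2 + τ)) 0 :=
              ContinuousAt.div (by fun_prop) (by fun_prop) (by positivity)
            have h5 := this.tendsto
            rw [add_zero, div_self (by positivity)] at h5
            exact h5.mono_left nhdsWithin_le_nhds
          have h5 := ((Complex.continuous_ofReal.tendsto _).comp h4).mul_const
            (((x k : ℂ) - Z)⁻¹ * ((x l : ℂ) - Z)⁻¹)
          simpa using h5
        unfold loopIntegrand
        exact (((((hp.const_mul _).add_const _).sub_const _).sub_const _).mul_const _).add_const _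
  refine tendsto_nhds_unique hlim (tendsto_const_nhds.congr' ?_)
  filter_upwards [hτev] with τ hτ
  exact (integral_regWeight_loop hβ hb hτ hZ hF).symm

theorem integral_laguerreEnsemble (f : (Fin m → ℝ) → ℂ) :
    ∫ x, f x ∂(laguerreEnsemble m β a)
      = (∫⁻ x : Fin m → ℝ, ENNReal.ofReal (laguerreWeight m β a x))⁻¹.toReal •
        ∫ x, (laguerreWeight m β a x : ℂ) * f x := by
  rw [laguerreEnsemble, integral_smul_measure]
  congr 1
  rw [integral_withDensity_eq_integral_toReal_smul
    (measurable_laguerreWeight m β a).ennreal_ofReal (by simp)]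
  congr 1
  ext x
  rw [ENNReal.toReal_ofReal (laguerreWeight_nonneg m β a x), Complex.real_smul]

/-- Loop equation of the Laguerre ensemble. The value inserted for the pair interaction is
`∑_{k < l} 1 / ((x_k - Z) (x_l - Z))`, see `two_mul_sum_pairs`. -/
theorem integral_loop_laguerreEnsemble (hβ : 0 < β) (ha : β / 2 * ((m : ℝ) - 1) < a)
    (hZ : 0 < Z.im) (hF : IsTestFunction F F') :
    ∫ x, loopIntegrand β (a - β / 2 * ((m : ℝ) - 1) - 1) Z F F'
      ((resolventTrace Z x ^ 2 - resolventSqTrace Z x) / 2) x ∂(laguerreEnsemble m β a) = 0 := by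
  have h := integral_regWeight_zero_loop (b := a - β / 2 * ((m : ℝ) - 1) - 1) hβ (by linarith) hZ hF
  simp only [regWeight_zero] at h
  rw [integral_laguerreEnsemble, h, smul_zero]

end

/-! ### The self-consistent equation and its moments -/

/-- The quadratic polynomial in `s` whose zero with positive imaginary part is the Stieltjes
transform at `z` of the Marchenko-Pastur law with ratio `d`. -/
noncomputable def mpQuad (d : ℝ) (z s : ℂ) : ℂ := z * s ^ 2 + (z - 1 + d) / d * s + 1 / d

/-- The Stieltjes transform at `z` of the empirical measure of the points `(d / m) x_i`, expressed
through the resolvent trace of the unscaled points `x_i`. -/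
noncomputable def empStieltjes {m : ℕ} (d : ℝ) (z : ℂ) (x : Fin m → ℝ) : ℂ :=
  resolventTrace ((m / d : ℝ) * z) x / d

section

variable {m : ℕ} {β d : ℝ} {z : ℂ}

theorem im_scaled (hz : 0 < z.im) (hd : 0 < d) (hm : 0 < m) : 0 < (((m / d : ℝ) : ℂ) * z).im := by
  rw [Complex.im_ofReal_mul]
  positivity

theorem sum_norm_resolvent_sq {Z : ℂ} (hZ : 0 < Z.im) (x : Fin m → ℝ) :
    ∑ i, ‖((x i : ℂ) - Z)⁻¹‖ ^ 2 = (resolventTrace Z x).im / Z.im := by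
  rw [eq_div_iff hZ.ne', Finset.sum_mul, resolventTrace, Complex.im_sum]
  refine Finset.sum_congr rfl fun i _ => ?_
  rw [Complex.inv_im, norm_inv, inv_pow, Complex.normSq_eq_norm_sq]
  simp
  ring

theorem im_empStieltjes_nonneg (hz : 0 < z.im) (hd : 0 < d) (hm : 0 < m) (x : Fin m → ℝ) :
    0 ≤ (empStieltjes d z x).im := by
  have hZ := im_scaled hz hd hm
  have h := sum_norm_resolvent_sq hZ x
  have h1 : 0 ≤ (resolventTrace (((m / d : ℝ) : ℂ) * z) x).im := by
    rw [eq_div_iff hZ.ne'] at h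
    rw [← h]
    positivity
  rw [empStieltjes, Complex.div_ofReal_im]
  positivity

theorem continuous_empStieltjes (hz : 0 < z.im) (hd : 0 < d) (hm : 0 < m) :
    Continuous (empStieltjes d z : (Fin m → ℝ) → ℂ) :=
  (continuous_resolventTrace (im_scaled hz hd hm)).div_const _

theorem exists_norm_empStieltjes_le (hz : 0 < z.im) (hd : 0 < d) (hm : 0 < m) :
    ∃ K : ℝ, ∀ x : Fin m → ℝ, ‖empStieltjes d z x‖ ≤ K := by
  refine ⟨m * (1 / (((m / d : ℝ) : ℂ) * z).im) / ‖(d : ℂ)‖, fun x => ?_⟩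
  rw [empStieltjes, norm_div]
  gcongr
  exact norm_resolventTrace_le (im_scaled hz hd hm) x

theorem hasDerivAt_empStieltjes (hz : 0 < z.im) (hd : 0 < d) (hm : 0 < m) (i : Fin m)
    (x : Fin m → ℝ) :
    HasDerivAt (fun t => empStieltjes d z (update x i t))
      (-(((x i : ℂ) - (m / d : ℝ) * z)⁻¹) ^ 2 / d) (x i) := by
  have hZ := im_scaled hz hd hm
  refine HasDerivAt.div_const ?_ _
  have h : HasDerivAt (fun t : ℝ => ((t : ℂ) - (m / d : ℝ) * z)⁻¹
      + ∑ j ∈ {i}ᶜ, ((x j : ℂ) - (m / d : ℝ) * z)⁻¹)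
      (-(((x i : ℂ) - (m / d : ℝ) * z)⁻¹) ^ 2) (x i) := (hasDerivAt_resolvent hZ (x i)).add_const _
  refine h.congr_of_eventuallyEq (Eventually.of_forall fun t => ?_)
  simp only [resolventTrace]
  rw [Fintype.sum_eq_add_sum_compl i, update_self]
  congr 1
  refine Finset.sum_congr rfl fun j hj => ?_
  rw [update_of_ne (by simpa using hj)]

open ComplexConjugate in
/-- `Q ^ q * conj Q ^ (q + 1)`, chosen so that `Q` times it is `|Q| ^ (2 q + 2)`. -/
noncomputable def momentTest (d : ℝ) (z : ℂ) (q : ℕ) (s : ℂ) : ℂ :=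
  mpQuad d z s ^ q * conj (mpQuad d z s) ^ (q + 1)

open ComplexConjugate in
/-- Derivative of `momentTest d z q` along a path with velocity `v`. -/
noncomputable def momentTestDeriv (d : ℝ) (z : ℂ) (q : ℕ) (s v : ℂ) : ℂ :=
  q * mpQuad d z s ^ (q - 1) * ((2 * z * s + (z - 1 + d) / d) * v) * conj (mpQuad d z s) ^ (q + 1)
    + mpQuad d z s ^ q * ((q + 1 : ℕ) * conj (mpQuad d z s) ^ q *
      conj ((2 * z * s + (z - 1 + d) / d) * v))

theorem mpQuad_mul_momentTest (d : ℝ) (z : ℂ) (q : ℕ) (s : ℂ) :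
    mpQuad d z s * momentTest d z q s = ((‖mpQuad d z s‖ ^ (2 * q + 2) : ℝ) : ℂ) := by
  rw [momentTest, ← mul_assoc, ← pow_succ', ← mul_pow, Complex.mul_conj, Complex.normSq_eq_norm_sq,
    ← Complex.ofReal_pow, ← pow_mul]
  ring_nf

theorem norm_momentTest (d : ℝ) (z : ℂ) (q : ℕ) (s : ℂ) :
    ‖momentTest d z q s‖ = ‖mpQuad d z s‖ ^ (2 * q + 1) := by
  rw [momentTest, norm_mul, norm_pow, norm_pow, RCLike.norm_conj, ← pow_add]
  ring_nf

theorem norm_momentTestDeriv_le (d : ℝ) (z : ℂ) (q : ℕ) (s v : ℂ) :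
    ‖momentTestDeriv d z q s v‖ ≤ (2 * q + 1) * ‖mpQuad d z s‖ ^ (2 * q) *
      (‖2 * z * s + (z - 1 + d) / d‖ * ‖v‖) := by
  refine (norm_add_le _ _).trans ?_
  simp only [norm_mul, norm_pow, RCLike.norm_conj, Complex.norm_natCast]
  set y := ‖mpQuad d z s‖
  set w := ‖2 * z * s + (z - 1 + d) / d‖ * ‖v‖
  have h1 : (q : ℝ) * y ^ (q - 1) * w * y ^ (q + 1) = q * y ^ (2 * q) * w := by
    rcases q with _ | q
    · simp
    · simp only [Nat.add_sub_cancel]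
      ring
  rw [h1]
  push_cast
  apply le_of_eq
  ring

theorem hasDerivAt_momentTest (d : ℝ) (z : ℂ) (q : ℕ) {f : ℝ → ℂ} {v : ℂ} {t : ℝ}
    (hf : HasDerivAt f v t) :
    HasDerivAt (fun t => momentTest d z q (f t)) (momentTestDeriv d z q (f t) v) t := by
  have hQ : HasDerivAt (fun t => mpQuad d z (f t)) ((2 * z * f t + (z - 1 + d) / d) * v) t := by
    refine (((hf.pow 2).const_mul z |>.add (hf.const_mul ((z - 1 + d) / d))).add_const
      (1 / (d : ℂ))).congr_deriv ?_
    push_cast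
    ring
  have h := (hQ.pow q).mul (hQ.star.pow (q + 1))
  exact h

theorem continuous_momentTest (d : ℝ) (z : ℂ) (q : ℕ) : Continuous (momentTest d z q) := by
  unfold momentTest mpQuad
  fun_prop

theorem continuous_momentTestDeriv (d : ℝ) (z : ℂ) (q : ℕ) :
    Continuous fun p : ℂ × ℂ => momentTestDeriv d z q p.1 p.2 := by
  unfold momentTestDeriv mpQuad
  fun_prop

theorem exists_norm_comp_empStieltjes_le {E : Type*} [SeminormedAddCommGroup E] (hz : 0 < z.im)
    (hd : 0 < d) (hm : 0 < m) {φ : ℂ → E} (hφ : Continuous φ) :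
    ∃ C : ℝ, ∀ x : Fin m → ℝ, ‖φ (empStieltjes d z x)‖ ≤ C := by
  obtain ⟨K, hK⟩ := exists_norm_empStieltjes_le hz hd hm
  obtain ⟨C, hC⟩ := (isCompact_closedBall (0 : ℂ) K).exists_bound_of_continuousOn hφ.continuousOn
  exact ⟨C, fun x => hC _ (by simpa using hK x)⟩

theorem continuous_neg_resolvent_sq (hz : 0 < z.im) (hd : 0 < d) (hm : 0 < m) (i : Fin m) :
    Continuous fun x : Fin m → ℝ => -(((x i : ℂ) - (m / d : ℝ) * z)⁻¹) ^ 2 / d :=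
  ((((continuous_resolvent (im_scaled hz hd hm)).comp (continuous_apply i)).pow 2).neg).div_const _

theorem continuous_momentTestDeriv_comp (hz : 0 < z.im) (hd : 0 < d) (hm : 0 < m) (q : ℕ)
    (i : Fin m) :
    Continuous fun x : Fin m → ℝ => momentTestDeriv d z q (empStieltjes d z x)
        (-(((x i : ℂ) - (m / d : ℝ) * z)⁻¹) ^ 2 / d) := by
  have h := (continuous_momentTestDeriv d z q).comp
    ((continuous_empStieltjes hz hd hm).prodMk (continuous_neg_resolvent_sq hz hd hm i))
  simpa only [Function.comp_def] using h

theorem isTestFunction_momentTest (hz : 0 < z.im) (hd : 0 < d) (hm : 0 < m) (q : ℕ) :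
    IsTestFunction (fun x : Fin m → ℝ => momentTest d z q (empStieltjes d z x))
      (fun i x => momentTestDeriv d z q (empStieltjes d z x)
        (-(((x i : ℂ) - (m / d : ℝ) * z)⁻¹) ^ 2 / d)) := by
  refine ⟨(continuous_momentTest d z q).comp (continuous_empStieltjes hz hd hm),
    continuous_momentTestDeriv_comp hz hd hm q,
    exists_norm_comp_empStieltjes_le hz hd hm (continuous_momentTest d z q), ?_, fun i x => ?_⟩
  · obtain ⟨C, hC⟩ := exists_norm_comp_empStieltjes_le (m := m) hz hd hm
      (φ := fun s => (2 * q + 1) * ‖mpQuad d z s‖ ^ (2 * q) * ‖2 * z * s + (z - 1 + d) / d‖)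
      (by unfold mpQuad; fun_prop)
    refine ⟨C * ((1 / (((m / d : ℝ) : ℂ) * z).im) ^ 2 / ‖(d : ℂ)‖), fun i x => ?_⟩
    refine (norm_momentTestDeriv_le _ _ _ _ _).trans ?_
    rw [← mul_assoc]
    refine mul_le_mul ((le_abs_self _).trans (hC x)) ?_ (norm_nonneg _)
      ((norm_nonneg _).trans (hC x))
    rw [norm_div, norm_neg, norm_pow]
    gcongr
    exact norm_resolvent_le (im_scaled hz hd hm) _
  · have := hasDerivAt_momentTest d z q (hasDerivAt_empStieltjes hz hd hm i x)
    simpa only [update_eq_self] using this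

/-- The error term of the loop equation for `momentTest`. -/
noncomputable def loopError (β d : ℝ) (z : ℂ) (q : ℕ) (x : Fin m → ℝ) : ℂ :=
  (β / 2 - 1) * (d * empStieltjes d z x + (m / d : ℝ) * z * resolventSqTrace ((m / d : ℝ) * z) x)
      * momentTest d z q (empStieltjes d z x)
    + ∑ i, x i * ((x i : ℂ) - (m / d : ℝ) * z)⁻¹ *
      momentTestDeriv d z q (empStieltjes d z x) (-(((x i : ℂ) - (m / d : ℝ) * z)⁻¹) ^ 2 / d)

theorem continuous_loopError (hz : 0 < z.im) (hd : 0 < d) (hm : 0 < m) (q : ℕ) :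
    Continuous (loopError β d z q : (Fin m → ℝ) → ℂ) := by
  have h1 := continuous_empStieltjes hz hd hm
  have h2 := continuous_resolventSqTrace (m := m) (im_scaled hz hd hm)
  have h3 := (continuous_momentTest d z q).comp h1
  refine ((continuous_const.mul ((continuous_const.mul h1).add (continuous_const.mul h2))).mul
    h3).add (continuous_finsetSum _ fun i _ => Continuous.mul ?_
      (continuous_momentTestDeriv_comp hz hd hm q i))
  exact (Complex.continuous_ofReal.comp (continuous_apply i)).mul
    ((continuous_resolvent (im_scaled hz hd hm)).comp (continuous_apply i))

/-- The bound for `loopError` in terms of the Stieltjes transform `s`. -/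
noncomputable def loopErrorBound (m : ℕ) (β d : ℝ) (z : ℂ) (q : ℕ) (s : ℂ) : ℝ :=
  |β / 2 - 1| * (d * (1 + ‖z‖ / z.im) * ‖s‖) * ‖mpQuad d z s‖ ^ (2 * q + 1)
    + (1 + ‖z‖ / z.im) * ((2 * q + 1) * ‖mpQuad d z s‖ ^ (2 * q) *
      ‖2 * z * s + (z - 1 + d) / d‖) * (d * ‖s‖ / (m * z.im))

theorem norm_loopError_le (hz : 0 < z.im) (hd : 0 < d) (hm : 0 < m) (q : ℕ) (x : Fin m → ℝ) :
    ‖loopError β d z q x‖ ≤ loopErrorBound m β d z q (empStieltjes d z x) := by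
  have hZ := im_scaled hz hd hm
  have hm' : (0 : ℝ) < m := by exact_mod_cast hm
  have hsum : ∑ i, ‖((x i : ℂ) - (m / d : ℝ) * z)⁻¹‖ ^ 2
      ≤ d ^ 2 * ‖empStieltjes d z x‖ / (m * z.im) := by
    rw [sum_norm_resolvent_sq hZ, Complex.im_ofReal_mul]
    have h1 : (resolventTrace (((m / d : ℝ) : ℂ) * z) x).im ≤ d * ‖empStieltjes d z x‖ := by
      refine (le_abs_self _).trans ((Complex.abs_im_le_norm _).trans ?_)
      rw [empStieltjes, norm_div, Complex.norm_real, Real.norm_of_nonneg hd.le,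
        mul_div_cancel₀ _ hd.ne']
    rw [div_le_div_iff₀ (by positivity) (by positivity)]
    calc _ ≤ d * ‖empStieltjes d z x‖ * (m * z.im) := by gcongr
      _ = _ := by field_simp
  have hsq : ‖resolventSqTrace (((m / d : ℝ) : ℂ) * z) x‖
      ≤ d ^ 2 * ‖empStieltjes d z x‖ / (m * z.im) := by
    refine (norm_sum_le _ _).trans (le_trans (le_of_eq ?_) hsum)
    exact Finset.sum_congr rfl fun i _ => norm_pow _ _
  have hG : ∀ i, ‖(x i : ℂ) * ((x i : ℂ) - (m / d : ℝ) * z)⁻¹‖ ≤ 1 + ‖z‖ / z.im := fun i => by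
    refine (norm_mul_resolvent_le hZ (x i)).trans (le_of_eq ?_)
    rw [Complex.im_ofReal_mul, norm_mul, Complex.norm_real, Real.norm_of_nonneg (by positivity),
      mul_div_mul_left _ _ (by positivity)]
  unfold loopError loopErrorBound
  refine (norm_add_le _ _).trans (add_le_add ?_ ((norm_sum_le _ _).trans ?_))
  · rw [norm_mul, norm_mul, norm_momentTest]
    have h1 : ‖(β / 2 - 1 : ℂ)‖ = |β / 2 - 1| := by
      rw [← Real.norm_eq_abs, ← Complex.norm_real]
      push_cast
      rfl
    rw [h1]
    gcongr
    refine (norm_add_le _ _).trans ?_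
    rw [norm_mul, norm_mul, norm_mul, Complex.norm_real, Complex.norm_real,
      Real.norm_of_nonneg hd.le, Real.norm_of_nonneg (by positivity)]
    calc _ ≤ d * ‖empStieltjes d z x‖
          + m / d * ‖z‖ * (d ^ 2 * ‖empStieltjes d z x‖ / (m * z.im)) := by gcongr
      _ = _ := by field_simp
  · set A := (2 * q + 1) * ‖mpQuad d z (empStieltjes d z x)‖ ^ (2 * q) *
      ‖2 * z * empStieltjes d z x + (z - 1 + d) / d‖ with hA
    have hA0 : 0 ≤ A := by positivity
    calc _ ≤ ∑ i, (1 + ‖z‖ / z.im) * A * (‖((x i : ℂ) - (m / d : ℝ) * z)⁻¹‖ ^ 2 / d) := by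
          refine Finset.sum_le_sum fun i _ => ?_
          rw [norm_mul, mul_assoc]
          refine mul_le_mul (hG i) ?_ (norm_nonneg _) (by positivity)
          refine (norm_momentTestDeriv_le _ _ _ _ _).trans (le_of_eq ?_)
          rw [norm_div, norm_neg, norm_pow, Complex.norm_real, Real.norm_of_nonneg hd.le, hA]
          ring
      _ = (1 + ‖z‖ / z.im) * A * ((∑ i, ‖((x i : ℂ) - (m / d : ℝ) * z)⁻¹‖ ^ 2) / d) := by
          rw [← Finset.mul_sum, ← Finset.sum_div]
      _ ≤ (1 + ‖z‖ / z.im) * A * (d ^ 2 * ‖empStieltjes d z x‖ / (m * z.im) / d) := by gcongr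
      _ = _ := by field_simp

theorem integrable_comp_empStieltjes {E : Type*} [NormedAddCommGroup E]
    (hz : 0 < z.im) (hd : 0 < d) (hm : 0 < m) {φ : ℂ → E} (hφ : Continuous φ)
    (μ : Measure (Fin m → ℝ)) [IsFiniteMeasure μ] :
    Integrable (fun x => φ (empStieltjes d z x)) μ := by
  obtain ⟨C, hC⟩ := exists_norm_comp_empStieltjes_le (m := m) hz hd hm hφ
  exact Integrable.of_bound (hφ.comp (continuous_empStieltjes hz hd hm)).aestronglyMeasurable C
    (Eventually.of_forall hC)

theorem continuous_mpQuad (d : ℝ) (z : ℂ) : Continuous (mpQuad d z) := by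
  unfold mpQuad
  fun_prop

theorem continuous_loopErrorBound {q : ℕ} : Continuous (loopErrorBound m β d z q) := by
  unfold loopErrorBound mpQuad
  fun_prop

/-- The loop equation for `momentTest`, solved for the moment of `mpQuad`. -/
theorem moment_eq (hβ : 0 < β) (hd : 0 < d) (hd1 : d ≤ 1) (hm : 0 < m) (hz : 0 < z.im) (q : ℕ) :
    ((β / 2 * m * d * ∫ x, ‖mpQuad d z (empStieltjes d z x)‖ ^ (2 * q + 2)
        ∂(laguerreEnsemble m β (m * β / (2 * d))) : ℝ) : ℂ)
      = ∫ x, loopError β d z q x ∂(laguerreEnsemble m β (m * β / (2 * d))) := by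
  have := isProbabilityMeasure_laguerreEnsemble' m β d hβ hd hd1
  have hF := isTestFunction_momentTest hz hd hm q
  have hZ := im_scaled hz hd hm
  have ha : β / 2 * ((m : ℝ) - 1) < m * β / (2 * d) := by
    rw [lt_div_iff₀ (by positivity)]
    have hm : (0 : ℝ) ≤ m := Nat.cast_nonneg m
    nlinarith [mul_nonneg hm (sub_nonneg.2 hd1), mul_pos hβ hd,
      mul_nonneg hβ.le (mul_nonneg hm (sub_nonneg.2 hd1))]
  have h := integral_loop_laguerreEnsemble hβ ha hZ hF
  rw [Complex.ofReal_mul, ← integral_complex_ofReal, ← integral_const_mul, ← sub_eq_zero,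
    ← integral_sub]
  · rw [← neg_eq_zero, ← integral_neg, ← h]
    congr 1
    ext x
    rw [← mpQuad_mul_momentTest]
    simp only [loopIntegrand, loopError]
    have hT : resolventTrace ((m / d : ℝ) * z) x = d * empStieltjes d z x := by
      rw [empStieltjes, mul_div_cancel₀]
      exact_mod_cast hd.ne'
    rw [hT, mpQuad]
    generalize empStieltjes d z x = s
    generalize resolventSqTrace ((m / d : ℝ) * z) x = T2
    have hdc : (d : ℂ) ≠ 0 := by exact_mod_cast hd.ne'
    push_cast
    field_simp
    ring
  · refine Integrable.const_mul (integrable_comp_empStieltjes hz hd hm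
      (φ := fun s => ((‖mpQuad d z s‖ ^ (2 * q + 2) : ℝ) : ℂ)) ?_ _) _
    exact Complex.continuous_ofReal.comp ((continuous_mpQuad d z).norm.pow _)
  · exact (integrable_comp_empStieltjes hz hd hm continuous_loopErrorBound _).mono'
      (continuous_loopError hz hd hm q).aestronglyMeasurable
      (Eventually.of_forall (norm_loopError_le hz hd hm q))

/-- Absorption step: terms carrying a small factor `t` are bounded by half of the highest moment
plus the correct power of `t`. -/
theorem exists_absorb (K : ℝ) (hK : 0 < K) (q : ℕ) :
    ∃ C t₀ : ℝ, 0 < C ∧ 0 < t₀ ∧ ∀ y t : ℝ, 0 ≤ y → 0 < t → t ≤ t₀ →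
      K * t * (1 + y) * y ^ (2 * q + 1) + K * t ^ 2 * (1 + y) * y ^ (2 * q)
        ≤ 1 / 2 * y ^ (2 * q + 2) + C * t ^ (2 * q + 2) := by
  set A := 8 * K + 8 with hA
  refine ⟨K * (1 + A) * (A ^ (2 * q + 1) + A ^ (2 * q)), min 1 (1 / (8 * K)), by positivity,
    by positivity, fun y t hy ht ht0 => ?_⟩
  have ht1 : t ≤ 1 := ht0.trans (min_le_left _ _)
  have ht2 : K * t ≤ 1 / 8 := by
    have := ht0.trans (min_le_right _ _)
    rw [le_div_iff₀ (by positivity)] at this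
    linarith
  have hA0 : 0 < A := by positivity
  rcases le_or_gt y (A * t) with h | h
  · have hyA : y ≤ A := h.trans (by nlinarith)
    have h3 : 0 ≤ 1 / 2 * y ^ (2 * q + 2) := by positivity
    calc _ ≤ K * t * (1 + A) * (A * t) ^ (2 * q + 1) + K * t ^ 2 * (1 + A) * (A * t) ^ (2 * q) := by
          gcongr
      _ = K * (1 + A) * (A ^ (2 * q + 1) + A ^ (2 * q)) * t ^ (2 * q + 2) := by
          rw [mul_pow, mul_pow]
          ring
      _ ≤ _ := by linarith
  · have hty : t ≤ y := by nlinarith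
    have h3 : K * t * (1 + y) * y + K * t ^ 2 * (1 + y) ≤ 1 / 2 * y ^ 2 := by
      have h4 : K * t ^ 2 * (1 + y) ≤ K * t * (1 + y) * y := by
        have : K * t * (1 + y) * t ≤ K * t * (1 + y) * y := by gcongr
        linarith
      have h5 : K * t ≤ y / 8 := by nlinarith
      have h6 : K * t * y ≤ y / 8 * y := by gcongr
      have h7 : K * t * (y * y) ≤ 1 / 8 * (y * y) := by gcongr
      nlinarith
    have h4 : 0 ≤ K * (1 + A) * (A ^ (2 * q + 1) + A ^ (2 * q)) * t ^ (2 * q + 2) := by positivity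
    have h5 : 0 ≤ y ^ (2 * q) := by positivity
    calc _ = (K * t * (1 + y) * y + K * t ^ 2 * (1 + y)) * y ^ (2 * q) := by ring
      _ ≤ 1 / 2 * y ^ 2 * y ^ (2 * q) := by gcongr
      _ = 1 / 2 * y ^ (2 * q + 2) := by ring
      _ ≤ _ := by linarith

/-- The Stieltjes transform is controlled by the quadratic polynomial alone, since the leading
coefficient `z` stays away from zero. -/
theorem exists_norm_sq_le_mpQuad (hd : 0 < d) {c M : ℝ} (hc : 0 < c) :
    ∃ C : ℝ, 0 < C ∧ ∀ z s : ℂ, c ≤ ‖z‖ → ‖z‖ ≤ M → ‖s‖ ^ 2 ≤ C * (1 + ‖mpQuad d z s‖) := by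
  set A := (|M| + 1 + d) / d with hA
  have hA0 : 0 < A := by positivity
  set B := A ^ 2 / (2 * c) + 1 / d with hB
  refine ⟨2 / c * (1 + B), by positivity, fun z s h1 h2 => ?_⟩
  have h3 : z * s ^ 2 = mpQuad d z s - (z - 1 + d) / d * s - 1 / d := by
    rw [mpQuad]; ring
  have h4 : ‖(z - 1 + d) / (d : ℂ)‖ ≤ A := by
    rw [norm_div, Complex.norm_real, Real.norm_of_nonneg hd.le, hA]
    gcongr
    refine (norm_add_le _ _).trans (add_le_add ((norm_sub_le _ _).trans ?_) ?_)
    · rw [norm_one]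
      linarith [le_abs_self M]
    · rw [Complex.norm_real, Real.norm_of_nonneg hd.le]
  have h5 : ‖(1 / d : ℂ)‖ = 1 / d := by
    rw [norm_div, Complex.norm_real, Real.norm_of_nonneg hd.le, norm_one]
  have h6 : c * ‖s‖ ^ 2 ≤ ‖mpQuad d z s‖ + A * ‖s‖ + 1 / d := by
    calc c * ‖s‖ ^ 2 ≤ ‖z * s ^ 2‖ := by rw [norm_mul, norm_pow]; gcongr
      _ ≤ ‖mpQuad d z s‖ + ‖(z - 1 + d) / (d : ℂ) * s‖ + ‖(1 / d : ℂ)‖ := by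
          rw [h3]
          exact (norm_sub_le _ _).trans (add_le_add_left (norm_sub_le _ _) _)
      _ ≤ _ := by
          rw [h5, norm_mul]
          gcongr
  have h7 : A * ‖s‖ ≤ c / 2 * ‖s‖ ^ 2 + A ^ 2 / (2 * c) := by
    have : c / 2 * ‖s‖ ^ 2 + A ^ 2 / (2 * c) - A * ‖s‖ = (c * ‖s‖ - A) ^ 2 / (2 * c) := by
      field_simp
      ring
    have h8 : 0 ≤ (c * ‖s‖ - A) ^ 2 / (2 * c) := by positivity
    linarith
  have h8 : c / 2 * ‖s‖ ^ 2 ≤ ‖mpQuad d z s‖ + B := by linarith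
  have hB0 : 0 < B := by positivity
  calc ‖s‖ ^ 2 = 2 / c * (c / 2 * ‖s‖ ^ 2) := by field_simp
    _ ≤ 2 / c * (‖mpQuad d z s‖ + B) := by gcongr
    _ ≤ 2 / c * ((1 + B) * (1 + ‖mpQuad d z s‖)) := by
        gcongr
        nlinarith [norm_nonneg (mpQuad d z s)]
    _ = _ := by ring

/-- Optimal moment bound for the self-consistent equation: in the spectral window
`c ≤ |z| ≤ M`, all moments of `mpQuad` are of order `1 / (m Im z)`. -/
theorem exists_moment_mpQuad_le (hβ : 0 < β) (hd : 0 < d) (hd1 : d ≤ 1) {c M : ℝ} (hc : 0 < c)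
    (q : ℕ) :
    ∃ C t₀ : ℝ, 0 < C ∧ 0 < t₀ ∧ ∀ m : ℕ, 0 < m → ∀ z : ℂ, 0 < z.im → c ≤ ‖z‖ → ‖z‖ ≤ M →
      1 / (m * z.im) ≤ t₀ →
      ∫ x, ‖mpQuad d z (empStieltjes d z x)‖ ^ (2 * q + 2)
        ∂(laguerreEnsemble m β (m * β / (2 * d))) ≤ C * (1 / (m * z.im)) ^ (2 * q + 2) := by
  obtain ⟨Cs, hCs, hs⟩ := exists_norm_sq_le_mpQuad (M := M) hd hc
  set M' := |M| + 1 with hM'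
  set L := 1 + 2 * M' + (M' + 1 + d) / d with hL
  set K := 2 / (β * d) * (|β / 2 - 1| * (d * (2 * M')) * (1 + Cs)
    + 2 * M' * (2 * q + 1) * d * L * (1 + 2 * Cs)) with hK
  have hM0 : 0 < M' := by positivity
  have hL0 : 0 < L := by positivity
  have hK0 : 0 < K := by positivity
  obtain ⟨C, t₀, hC, ht₀, habs⟩ := exists_absorb K hK0 q
  refine ⟨2 * C, t₀, by positivity, ht₀, fun m hm z hz h1 h2 ht => ?_⟩
  have := isProbabilityMeasure_laguerreEnsemble' m β d hβ hd hd1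
  have hm' : (0 : ℝ) < m := by exact_mod_cast hm
  set t := 1 / (m * z.im) with htdef
  have ht0 : 0 < t := by positivity
  have hzM : ‖z‖ ≤ M' := by linarith [le_abs_self M]
  have hzi : z.im ≤ M' := (le_abs_self _).trans ((Complex.abs_im_le_norm z).trans hzM)
  have hpt : ∀ s : ℂ, loopErrorBound m β d z q s ≤ β / 2 * m * d *
      (1 / 2 * ‖mpQuad d z s‖ ^ (2 * q + 2) + C * t ^ (2 * q + 2)) := fun s => by
    set y := ‖mpQuad d z s‖ with hy
    have hy0 : 0 ≤ y := norm_nonneg _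
    have hs2 : ‖s‖ ^ 2 ≤ Cs * (1 + y) := hs z s h1 h2
    have hs1 : ‖s‖ ≤ (1 + Cs) * (1 + y) := by nlinarith [sq_nonneg (‖s‖ - 1), norm_nonneg s]
    have hs3 : (1 + ‖s‖) * ‖s‖ ≤ (1 + 2 * Cs) * (1 + y) := by
      nlinarith [sq_nonneg (‖s‖ - 1), norm_nonneg s]
    have hG : 1 + ‖z‖ / z.im ≤ 2 * M' / z.im := by
      rw [le_div_iff₀ hz, add_mul, div_mul_cancel₀ _ hz.ne']
      linarith
    have hW : ‖2 * z * s + (z - 1 + d) / d‖ ≤ L * (1 + ‖s‖) := by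
      have h4 : ‖(z - 1 + d) / (d : ℂ)‖ ≤ (M' + 1 + d) / d := by
        rw [norm_div, Complex.norm_real, Real.norm_of_nonneg hd.le]
        gcongr
        refine (norm_add_le _ _).trans (add_le_add ((norm_sub_le _ _).trans ?_) ?_)
        · rw [norm_one]
          linarith
        · rw [Complex.norm_real, Real.norm_of_nonneg hd.le]
      refine (norm_add_le _ _).trans ?_
      rw [norm_mul, norm_mul, Complex.norm_ofNat]
      have h5 : 2 * ‖z‖ * ‖s‖ ≤ 2 * M' * ‖s‖ := by gcongr
      have h6 : 0 ≤ (M' + 1 + d) / d := by positivity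
      have h7 := mul_nonneg h6 (norm_nonneg s)
      rw [hL]
      nlinarith [norm_nonneg s, hM0]
    have hab := habs y t hy0 ht0 ht
    have hbd : loopErrorBound m β d z q s ≤ β / 2 * m * d *
        (K * t * (1 + y) * y ^ (2 * q + 1) + K * t ^ 2 * (1 + y) * y ^ (2 * q)) := by
      calc loopErrorBound m β d z q s
          ≤ |β / 2 - 1| * (d * (2 * M' / z.im) * ((1 + Cs) * (1 + y))) * y ^ (2 * q + 1)
            + (2 * M' / z.im) * (2 * q + 1) * y ^ (2 * q) * L * (d / (m * z.im))
              * ((1 + 2 * Cs) * (1 + y)) := by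
            unfold loopErrorBound
            refine add_le_add (by gcongr) ?_
            calc _ ≤ (2 * M' / z.im) * ((2 * q + 1) * y ^ (2 * q) * (L * (1 + ‖s‖)))
                  * (d * ‖s‖ / (m * z.im)) := by gcongr
              _ = (2 * M' / z.im) * (2 * q + 1) * y ^ (2 * q) * L * (d / (m * z.im))
                  * ((1 + ‖s‖) * ‖s‖) := by ring
              _ ≤ _ := by gcongr
        _ = β / 2 * m * d *
            ((2 / (β * d) * (|β / 2 - 1| * (d * (2 * M')) * (1 + Cs))) * t * (1 + y)
              * y ^ (2 * q + 1)
            + (2 / (β * d) * (2 * M' * (2 * q + 1) * d * L * (1 + 2 * Cs))) * t ^ 2 * (1 + y)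
              * y ^ (2 * q)) := by
            rw [htdef]
            field_simp
        _ ≤ _ := by
            have e1 : 0 ≤ |β / 2 - 1| * (d * (2 * M')) * (1 + Cs) := by positivity
            have e2 : 0 ≤ 2 * M' * (2 * q + 1) * d * L * (1 + 2 * Cs) := by positivity
            rw [hK]
            gcongr <;> linarith
    exact hbd.trans (by gcongr)
  set X := ∫ x, ‖mpQuad d z (empStieltjes d z x)‖ ^ (2 * q + 2)
        ∂(laguerreEnsemble m β (m * β / (2 * d))) with hX
  have hXi : Integrable (fun x => ‖mpQuad d z (empStieltjes d z x)‖ ^ (2 * q + 2))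
      (laguerreEnsemble m β (m * β / (2 * d))) :=
    integrable_comp_empStieltjes hz hd hm (φ := fun s => ‖mpQuad d z s‖ ^ (2 * q + 2))
      ((continuous_mpQuad d z).norm.pow _) _
  have hX0 : 0 ≤ X := integral_nonneg fun x => by positivity
  have heq := congrArg norm (moment_eq hβ hd hd1 hm hz q)
  rw [Complex.norm_real, Real.norm_of_nonneg (by positivity)] at heq
  have hle : β / 2 * m * d * X ≤ β / 2 * m * d * (1 / 2 * X + C * t ^ (2 * q + 2)) := by
    rw [heq]
    refine (norm_integral_le_of_norm_le (((hXi.const_mul (1 / 2)).add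
      (integrable_const (C * t ^ (2 * q + 2)))).const_mul (β / 2 * m * d))
      (Eventually.of_forall fun x => (norm_loopError_le hz hd hm q x).trans (hpt _))).trans
      (le_of_eq ?_)
    rw [integral_const_mul]
    congr 1
    simp only [Pi.add_apply]
    rw [integral_add (hXi.const_mul _) (integrable_const _), integral_const_mul]
    simp [hX]
  have := le_of_mul_le_mul_left hle (by positivity)
  linarith

end

/-! ### Stability in the bulk -/

/-- The bulk of the Marchenko-Pastur law at distance `κ` from the edges. -/
def mpBulk (d κ : ℝ) : Set ℝ := Icc (mpLower d + κ) (mpUpper d - κ)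

section

variable {d κ : ℝ}

theorem mpUpper_sub_mul_sub_mpLower (hd : 0 ≤ d) (E : ℝ) :
    (mpUpper d - E) * (E - mpLower d) = 4 * d * E - (E + d - 1) ^ 2 := by
  have h := Real.sq_sqrt hd
  unfold mpUpper mpLower
  have h1 : ((1 + √d) ^ 2 - E) * (E - (1 - √d) ^ 2)
      = 4 * √d ^ 2 - (E - 1 - √d ^ 2) ^ 2 := by ring
  rw [h1, h]
  ring

theorem mpUpper_le (hd1 : d ≤ 1) : mpUpper d ≤ 4 := by
  have := Real.sqrt_le_one.2 hd1
  have := Real.sqrt_nonneg d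
  unfold mpUpper
  nlinarith

theorem mpLower_nonneg : 0 ≤ mpLower d := sq_nonneg _

theorem mem_mpBulk_bounds (hd1 : d ≤ 1) {E : ℝ} (hE : E ∈ mpBulk d κ) : κ ≤ E ∧ E ≤ 4 - κ :=
  ⟨by linarith [hE.1, mpLower_nonneg (d := d)], by linarith [hE.2, mpUpper_le hd1]⟩

theorem mpDensity_of_mem_bulk (hκ : 0 < κ) {E : ℝ} (hE : E ∈ mpBulk d κ) :
    mpDensity d E = 1 / (2 * d * Real.pi * E) * √((mpUpper d - E) * (E - mpLower d)) := by
  rw [mpDensity, indicator_of_mem]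
  exact ⟨by linarith [hE.1], by linarith [hE.2]⟩

theorem measurable_mpDensity : Measurable (mpDensity d) := by
  have : mpDensity d = (Icc (mpLower d) (mpUpper d)).indicator
    (fun x => 1 / (2 * d * Real.pi * x) * √((mpUpper d - x) * (x - mpLower d))) := rfl
  rw [this]
  refine Measurable.indicator ?_ measurableSet_Icc
  fun_prop

theorem mpDensity_nonneg (hd : 0 < d) (E : ℝ) : 0 ≤ mpDensity d E := by
  refine indicator_nonneg (fun x hx => ?_) E
  have : 0 ≤ x := mpLower_nonneg.trans hx.1
  have := Real.pi_pos
  positivity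

theorem exists_mpDensity_le (hd : 0 < d) (hd1 : d ≤ 1) (hκ : 0 < κ) :
    ∃ M : ℝ, 0 < M ∧ ∀ E ∈ mpBulk d κ, mpDensity d E ≤ M := by
  have hpi := Real.pi_pos
  refine ⟨1 / (2 * d * Real.pi * κ) * 4, by positivity, fun E hE => ?_⟩
  rw [mpDensity_of_mem_bulk hκ hE]
  obtain ⟨h1, h2⟩ := mem_mpBulk_bounds hd1 hE
  have h3 : √((mpUpper d - E) * (E - mpLower d)) ≤ 4 := by
    rw [Real.sqrt_le_left (by norm_num)]
    have h4 := mpUpper_le hd1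
    have h5 := mpLower_nonneg (d := d)
    have h6 : 0 ≤ mpUpper d - E := by linarith [hE.2]
    have h7 : 0 ≤ E - mpLower d := by linarith [hE.1]
    calc _ ≤ (4 : ℝ) * 4 := mul_le_mul (by linarith) (by linarith) h7 (by norm_num)
      _ = 4 ^ 2 := by norm_num
  gcongr

/-- On the real axis inside the bulk, `mpQuad` has two complex conjugate zeros, whose imaginary
part is `π` times the Marchenko-Pastur density. -/
theorem mpQuad_ofReal_eq (hd : 0 < d) {E v : ℝ} (hE : 0 < E)
    (hv : v ^ 2 * (2 * d * E) ^ 2 = (mpUpper d - E) * (E - mpLower d)) (s : ℂ) :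
    mpQuad d E s = E * ((s - (((1 - d - E) / (2 * d * E) : ℝ) + v * Complex.I))
      * (s - (((1 - d - E) / (2 * d * E) : ℝ) - v * Complex.I))) := by
  rw [mpUpper_sub_mul_sub_mpLower hd.le] at hv
  have hv' : (v : ℂ) ^ 2 * (2 * d * E) ^ 2 = 4 * d * E - (E + d - 1) ^ 2 := by exact_mod_cast hv
  have hdc : (d : ℂ) ≠ 0 := by exact_mod_cast hd.ne'
  have hEc : (E : ℂ) ≠ 0 := by exact_mod_cast hE.ne'
  have h1 : (s - (((1 - d - E) / (2 * d * E) : ℝ) + v * Complex.I))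
      * (s - (((1 - d - E) / (2 * d * E) : ℝ) - v * Complex.I))
      = (s - ((1 - d - E) / (2 * d * E) : ℝ)) ^ 2 + v ^ 2 := by
    linear_combination (-(v : ℂ) ^ 2) * Complex.I_sq
  have h2 : (v : ℂ) ^ 2 = (4 * d * E - (E + d - 1) ^ 2) / (2 * d * E) ^ 2 := by
    rw [eq_div_iff (pow_ne_zero 2 (mul_ne_zero (mul_ne_zero two_ne_zero hdc) hEc)), hv']
  rw [h1, h2, mpQuad]
  push_cast
  field_simp
  ring

/-- Stability: in the bulk, `mpQuad` controls the distance to the Marchenko-Pastur density for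
every `s` in the upper half plane, because the other zero lies in the lower half plane. -/
theorem exists_abs_im_sub_le (hd : 0 < d) (hd1 : d ≤ 1) (hκ : 0 < κ) :
    ∃ C : ℝ, 0 < C ∧ ∀ E ∈ mpBulk d κ, ∀ η : ℝ, 0 < η → η ≤ 1 → ∀ s : ℂ, 0 ≤ s.im →
      |s.im - Real.pi * mpDensity d E| ≤ C * (‖mpQuad d (E + η * Complex.I) s‖ + η) := by
  obtain ⟨Cs, hCs, hs⟩ := exists_norm_sq_le_mpQuad (M := 5) hd hκ
  set B := 1 + (1 + 1 / d) * (1 + Cs) with hB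
  have hB1 : 1 ≤ B := by
    have : 0 ≤ (1 + 1 / d) * (1 + Cs) := by positivity
    linarith
  refine ⟨2 * d / κ * B, by positivity, fun E hE η hη hη1 s hs0 => ?_⟩
  obtain ⟨h1, h2⟩ := mem_mpBulk_bounds hd1 hE
  have hE0 : 0 < E := hκ.trans_le h1
  set v := Real.pi * mpDensity d E with hv
  set D := (mpUpper d - E) * (E - mpLower d) with hD
  have hDκ : κ ^ 2 ≤ D := by
    rw [hD, sq]
    exact mul_le_mul (by linarith [hE.2]) (by linarith [hE.1]) hκ.le (by linarith [hE.2])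
  have hpi := Real.pi_pos
  have hv1 : v * (2 * d * E) = √D := by
    rw [hv, mpDensity_of_mem_bulk hκ hE]
    field_simp
    rfl
  have hv2 : v ^ 2 * (2 * d * E) ^ 2 = D := by
    rw [← mul_pow, hv1, Real.sq_sqrt (by nlinarith)]
  have hvE : κ / (2 * d) ≤ E * v := by
    rw [div_le_iff₀ (by positivity)]
    have : κ ≤ √D := Real.le_sqrt_of_sq_le hDκ
    linarith
  have hv0 : 0 ≤ v := mul_nonneg hpi.le (mpDensity_nonneg hd E)
  set z : ℂ := E + η * Complex.I with hz
  have hzre : z.re = E := by simp [hz]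
  have hz1 : κ ≤ ‖z‖ := h1.trans (by rw [← hzre]; exact Complex.re_le_norm z)
  have hz2 : ‖z‖ ≤ 5 := by
    refine (norm_add_le _ _).trans ?_
    rw [norm_mul, Complex.norm_I, Complex.norm_real, Complex.norm_real,
      Real.norm_of_nonneg hE0.le, Real.norm_of_nonneg hη.le]
    linarith
  set y := ‖mpQuad d z s‖ with hy
  have hy0 : 0 ≤ y := norm_nonneg _
  have hs2 : ‖s‖ ^ 2 ≤ Cs * (1 + y) := hs z s hz1 hz2
  have hQE : ‖mpQuad d E s‖ ≤ y + η * ((1 + 1 / d) * ((1 + Cs) * (1 + y))) := by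
    have e : mpQuad d E s = mpQuad d z s - η * Complex.I * (s ^ 2 + s / d) := by
      simp only [mpQuad, hz]
      ring
    rw [e]
    refine (norm_sub_le _ _).trans (add_le_add le_rfl ?_)
    rw [norm_mul, norm_mul, Complex.norm_I, Complex.norm_real, Real.norm_of_nonneg hη.le, mul_one]
    gcongr
    refine (norm_add_le _ _).trans ?_
    rw [norm_pow, norm_div, Complex.norm_real, Real.norm_of_nonneg hd.le]
    have e1 : ‖s‖ ^ 2 ≤ (1 + Cs) * (1 + y) := by nlinarith
    have e2 : ‖s‖ ≤ (1 + Cs) * (1 + y) := by nlinarith [sq_nonneg (‖s‖ - 1), norm_nonneg s]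
    calc _ ≤ (1 + Cs) * (1 + y) + (1 + Cs) * (1 + y) / d := by gcongr
      _ = _ := by ring
  have hQB : ‖mpQuad d E s‖ ≤ B * (y + η) := by
    refine hQE.trans ?_
    have e0 : 0 ≤ (1 + 1 / d) * (1 + Cs) := by positivity
    have e1 : η * ((1 + 1 / d) * (1 + Cs) * y) ≤ 1 * ((1 + 1 / d) * (1 + Cs) * y) := by gcongr
    rw [hB]
    nlinarith
  have hfac := mpQuad_ofReal_eq hd hE0 hv2 s
  generalize (1 - d - E) / (2 * d * E) = r at hfac
  set w₁ : ℂ := r + v * Complex.I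
  set w₂ : ℂ := r - v * Complex.I
  have e1 : |s.im - v| ≤ ‖s - w₁‖ := by
    have := Complex.abs_im_le_norm (s - w₁)
    have h : (s - w₁).im = s.im - v := by simp [w₁]
    rwa [h] at this
  have e2 : v ≤ ‖s - w₂‖ := by
    have := Complex.abs_im_le_norm (s - w₂)
    have h : (s - w₂).im = s.im + v := by simp [w₂]
    rw [h] at this
    linarith [le_abs_self (s.im + v)]
  have e3 : κ / (2 * d) * |s.im - v| ≤ ‖mpQuad d E s‖ := by
    rw [hfac, norm_mul, norm_mul, Complex.norm_real, Real.norm_of_nonneg hE0.le]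
    calc κ / (2 * d) * |s.im - v| ≤ (E * v) * |s.im - v| := by gcongr
      _ = E * (|s.im - v| * v) := by ring
      _ ≤ _ := by gcongr
  calc |s.im - v| = 2 * d / κ * (κ / (2 * d) * |s.im - v|) := by field_simp
    _ ≤ 2 * d / κ * (B * (y + η)) :=
        mul_le_mul_of_nonneg_left (e3.trans hQB) (by positivity)
    _ = _ := by ring

end

/-! ### Averaged deviation of the smoothed density -/

/-- Deviation at energy `E` and scale `η` of the imaginary part of the empirical Stieltjes
transform from `π` times the Marchenko-Pastur density. -/
noncomputable def mpDev {m : ℕ} (d η : ℝ) (x : Fin m → ℝ) (E : ℝ) : ℝ :=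
  |(empStieltjes d (E + η * Complex.I) x).im - Real.pi * mpDensity d E|

section

variable {m : ℕ} {β d κ η : ℝ}

theorem mpDev_nonneg (x : Fin m → ℝ) (E : ℝ) : 0 ≤ mpDev d η x E := abs_nonneg _

theorem im_energy (E η : ℝ) : ((E : ℂ) + η * Complex.I).im = η := by simp

theorem measurable_uncurry_empStieltjes :
    Measurable fun p : (Fin m → ℝ) × ℝ => empStieltjes d (p.2 + η * Complex.I) p.1 := by
  unfold empStieltjes resolventTrace
  fun_prop

theorem measurable_uncurry_mpDev :
    Measurable fun p : (Fin m → ℝ) × ℝ => mpDev d η p.1 p.2 := by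
  have h1 := Complex.measurable_im.comp (measurable_uncurry_empStieltjes (m := m) (d := d) (η := η))
  have h2 : Measurable fun p : (Fin m → ℝ) × ℝ => mpDensity d p.2 :=
    measurable_mpDensity.comp measurable_snd
  exact (h1.sub (h2.const_mul Real.pi)).abs

theorem exists_mpDev_le (hd : 0 < d) (hd1 : d ≤ 1) (hκ : 0 < κ) (hm : 0 < m) (hη : 0 < η) :
    ∃ K : ℝ, ∀ (x : Fin m → ℝ), ∀ E ∈ mpBulk d κ, mpDev d η x E ≤ K := by
  obtain ⟨M, hM, hM'⟩ := exists_mpDensity_le hd hd1 hκ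
  have hm' : (0 : ℝ) < m := by exact_mod_cast hm
  have hpi := Real.pi_pos
  refine ⟨m * (1 / (m / d * η)) / d + Real.pi * M, fun x E hE => ?_⟩
  refine (abs_sub _ _).trans (add_le_add ?_ ?_)
  · refine (Complex.abs_im_le_norm _).trans ?_
    rw [empStieltjes, norm_div, Complex.norm_real, Real.norm_of_nonneg hd.le]
    gcongr
    have hz : 0 < ((E : ℂ) + η * Complex.I).im := by rwa [im_energy]
    have := norm_resolventTrace_le (im_scaled hz hd hm) x
    rwa [Complex.im_ofReal_mul, im_energy] at this
  · rw [abs_of_nonneg (mul_nonneg hpi.le (mpDensity_nonneg hd E))]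
    gcongr
    exact hM' E hE

/-- Moments of the pointwise deviation. -/
theorem exists_moment_mpDev_le (hβ : 0 < β) (hd : 0 < d) (hd1 : d ≤ 1) (hκ : 0 < κ) (q : ℕ) :
    ∃ C t₀ : ℝ, 0 < C ∧ 0 < t₀ ∧ ∀ m : ℕ, 0 < m → ∀ η : ℝ, 0 < η → η ≤ 1 → 1 / (m * η) ≤ t₀ →
      ∀ E ∈ mpBulk d κ,
      ∫ x, mpDev d η x E ^ (2 * q + 2) ∂(laguerreEnsemble m β (m * β / (2 * d)))
        ≤ C * ((1 / (m * η)) ^ (2 * q + 2) + η ^ (2 * q + 2)) := by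
  obtain ⟨C1, hC1, hst⟩ := exists_abs_im_sub_le hd hd1 hκ
  obtain ⟨C2, t₀, hC2, ht₀, hmom⟩ := exists_moment_mpQuad_le (M := 5) hβ hd hd1 hκ q
  set n := 2 * q + 2 with hn
  refine ⟨C1 ^ n * 2 ^ (n - 1) * (C2 + 1), t₀, by positivity, ht₀, fun m hm η hη hη1 ht E hE => ?_⟩
  have := isProbabilityMeasure_laguerreEnsemble' m β d hβ hd hd1
  obtain ⟨h1, h2⟩ := mem_mpBulk_bounds hd1 hE
  have hE0 : 0 < E := hκ.trans_le h1
  set z : ℂ := E + η * Complex.I with hz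
  have hzim : z.im = η := im_energy E η
  have hzp : 0 < z.im := by rwa [hzim]
  have hzre : z.re = E := by simp [hz]
  have hz1 : κ ≤ ‖z‖ := h1.trans (by rw [← hzre]; exact Complex.re_le_norm z)
  have hz2 : ‖z‖ ≤ 5 := by
    refine (norm_add_le _ _).trans ?_
    rw [norm_mul, Complex.norm_I, Complex.norm_real, Complex.norm_real,
      Real.norm_of_nonneg hE0.le, Real.norm_of_nonneg hη.le]
    linarith
  have hm2 := hmom m hm z hzp hz1 hz2 (by rwa [hzim])
  rw [hzim] at hm2
  have hXi : Integrable (fun x => ‖mpQuad d z (empStieltjes d z x)‖ ^ n)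
      (laguerreEnsemble m β (m * β / (2 * d))) :=
    integrable_comp_empStieltjes hzp hd hm (φ := fun s => ‖mpQuad d z s‖ ^ n)
      ((continuous_mpQuad d z).norm.pow _) _
  have hpt : ∀ x : Fin m → ℝ, mpDev d η x E ^ n
      ≤ C1 ^ n * 2 ^ (n - 1) * (‖mpQuad d z (empStieltjes d z x)‖ ^ n + η ^ n) := fun x => by
    have h3 := hst E hE η hη hη1 (empStieltjes d z x) (im_empStieltjes_nonneg hzp hd hm x)
    calc mpDev d η x E ^ n ≤ (C1 * (‖mpQuad d z (empStieltjes d z x)‖ + η)) ^ n :=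
          pow_le_pow_left₀ (mpDev_nonneg x E) h3 n
      _ = C1 ^ n * (‖mpQuad d z (empStieltjes d z x)‖ + η) ^ n := mul_pow _ _ _
      _ ≤ C1 ^ n * (2 ^ (n - 1) * (‖mpQuad d z (empStieltjes d z x)‖ ^ n + η ^ n)) := by
          gcongr
          exact add_pow_le (norm_nonneg _) hη.le n
      _ = _ := by ring
  calc _ ≤ ∫ x, C1 ^ n * 2 ^ (n - 1) * (‖mpQuad d z (empStieltjes d z x)‖ ^ n + η ^ n)
        ∂(laguerreEnsemble m β (m * β / (2 * d))) :=
        integral_mono_of_nonneg (Eventually.of_forall fun x => pow_nonneg (mpDev_nonneg x E) n)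
          ((hXi.add (integrable_const _)).const_mul _) (Eventually.of_forall hpt)
    _ = C1 ^ n * 2 ^ (n - 1) * ((∫ x, ‖mpQuad d z (empStieltjes d z x)‖ ^ n
        ∂(laguerreEnsemble m β (m * β / (2 * d)))) + η ^ n) := by
        rw [integral_const_mul, integral_add hXi (integrable_const _)]
        simp
    _ ≤ C1 ^ n * 2 ^ (n - 1) * (C2 * (1 / (m * η)) ^ n + η ^ n) := by gcongr
    _ ≤ C1 ^ n * 2 ^ (n - 1) * ((C2 + 1) * ((1 / (m * η)) ^ n + η ^ n)) := by
        gcongr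
        have e1 : 0 ≤ (1 / (m * η)) ^ n := by positivity
        have e2 : 0 ≤ η ^ n := by positivity
        nlinarith
    _ = _ := by ring

theorem intervalIntegrable_mpDev_pow (hd : 0 < d) (hd1 : d ≤ 1) (hκ : 0 < κ) (hm : 0 < m)
    (hη : 0 < η) (x : Fin m → ℝ) (n : ℕ) {A B : ℝ} (hAB : A ≤ B) (hJ : Icc A B ⊆ mpBulk d κ) :
    IntervalIntegrable (fun E => mpDev d η x E ^ n) volume A B := by
  obtain ⟨K, hK⟩ := exists_mpDev_le (η := η) hd hd1 hκ hm hη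
  rw [intervalIntegrable_iff_integrableOn_Ioc_of_le hAB]
  have hmeas : Measurable fun E => mpDev d η x E ^ n :=
    ((measurable_uncurry_mpDev).comp (measurable_const.prodMk measurable_id)).pow_const n
  refine Measure.integrableOn_of_bounded (M := K ^ n) (by simp) hmeas.aestronglyMeasurable ?_
  refine (ae_restrict_iff' measurableSet_Ioc).2 (Eventually.of_forall fun E hE => ?_)
  rw [norm_pow, Real.norm_of_nonneg (mpDev_nonneg x E)]
  exact pow_le_pow_left₀ (mpDev_nonneg x E) (hK x E (hJ (Ioc_subset_Icc_self hE))) n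

/-- Markov's inequality for the deviation averaged over an interval of the bulk, whose length does
not enter the bound. -/
theorem exists_measure_integral_mpDev_le (hβ : 0 < β) (hd : 0 < d) (hd1 : d ≤ 1) (hκ : 0 < κ)
    {γ : ℝ} (hγ : 0 < γ) (q : ℕ) :
    ∃ C t₀ : ℝ, 0 < C ∧ 0 < t₀ ∧ ∀ m : ℕ, 0 < m → ∀ η : ℝ, 0 < η → η ≤ 1 → 1 / (m * η) ≤ t₀ →
      ∀ A B : ℝ, A < B → Icc A B ⊆ mpBulk d κ →
      (laguerreEnsemble m β (m * β / (2 * d))).real {x | γ * (B - A) ≤ ∫ E in A..B, mpDev d η x E}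
        ≤ C * ((1 / (m * η)) ^ (2 * q + 2) + η ^ (2 * q + 2)) := by
  obtain ⟨C, t₀, hC, ht₀, hmom⟩ := exists_moment_mpDev_le hβ hd hd1 hκ q
  refine ⟨(2 / γ) ^ (2 * q + 2) * C, t₀, by positivity, ht₀,
    fun m hm η hη hη1 ht A B hAB hJ => ?_⟩
  set n := 2 * q + 2 with hn
  set μ := laguerreEnsemble m β (m * β / (2 * d)) with hμ
  have : IsProbabilityMeasure μ := isProbabilityMeasure_laguerreEnsemble' m β d hβ hd hd1
  set U := (1 / (m * η)) ^ n + η ^ n with hU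
  have hBA : 0 < B - A := by linarith
  have hsub : {x : Fin m → ℝ | γ * (B - A) ≤ ∫ E in A..B, mpDev d η x E}
      ⊆ {x | (γ / 2) ^ n * (B - A) ≤ ∫ E in A..B, mpDev d η x E ^ n} := fun x hx => by
    have hi1 := intervalIntegrable_mpDev_pow hd hd1 hκ hm hη x 1 hAB.le hJ
    have hin := intervalIntegrable_mpDev_pow hd hd1 hκ hm hη x n hAB.le hJ
    simp only [pow_one] at hi1
    -- below the level `γ / 2` the deviation is harmless, above it a higher power dominates it
    have hpt : ∀ E ∈ Icc A B, mpDev d η x E ≤ γ / 2 + (2 / γ) ^ (2 * q + 1) * mpDev d η x E ^ n := by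
      intro E _
      have h0 := mpDev_nonneg (d := d) (η := η) x E
      set y := mpDev d η x E
      rcases le_or_gt y (γ / 2) with h | h
      · have : 0 ≤ (2 / γ) ^ (2 * q + 1) * y ^ n := by positivity
        linarith
      · have h1 : 1 ≤ 2 / γ * y := by
          rw [div_mul_eq_mul_div, le_div_iff₀ hγ]
          linarith
        have h2 : 1 ≤ (2 / γ * y) ^ (2 * q + 1) := one_le_pow₀ h1
        have h3 : (2 / γ) ^ (2 * q + 1) * y ^ n = (2 / γ * y) ^ (2 * q + 1) * y := by
          rw [hn, mul_pow]; ring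
        rw [h3]
        nlinarith
    have h1 := intervalIntegral.integral_mono_on hAB.le hi1
      ((intervalIntegrable_const (c := γ / 2)).add (hin.const_mul _)) hpt
    rw [intervalIntegral.integral_add intervalIntegrable_const (hin.const_mul _),
      intervalIntegral.integral_const_mul, intervalIntegral.integral_const, smul_eq_mul] at h1
    have hx' : γ * (B - A) ≤ ∫ E in A..B, mpDev d η x E := hx
    have h2 : (B - A) * (γ / 2) ≤ (2 / γ) ^ (2 * q + 1) * ∫ E in A..B, mpDev d η x E ^ n := by
      linarith
    change (γ / 2) ^ n * (B - A) ≤ _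
    have h3 : (γ / 2) ^ (2 * q + 1) * ((B - A) * (γ / 2))
        ≤ (γ / 2) ^ (2 * q + 1) * ((2 / γ) ^ (2 * q + 1) * ∫ E in A..B, mpDev d η x E ^ n) := by
      gcongr
    have h4 : (γ / 2) ^ (2 * q + 1) * (2 / γ) ^ (2 * q + 1) = 1 := by
      rw [← mul_pow]
      have : γ / 2 * (2 / γ) = 1 := by field_simp
      rw [this, one_pow]
    rw [← mul_assoc ((γ / 2) ^ (2 * q + 1)) ((2 / γ) ^ (2 * q + 1)), h4, one_mul] at h3
    calc _ = (γ / 2) ^ (2 * q + 1) * ((B - A) * (γ / 2)) := by rw [hn]; ring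
      _ ≤ _ := h3
  obtain ⟨K, hK⟩ := exists_mpDev_le (η := η) hd hd1 hκ hm hη
  have hprod : Integrable (uncurry fun (x : Fin m → ℝ) E => mpDev d η x E ^ n)
      (μ.prod (volume.restrict (Ioc A B))) := by
    refine Integrable.of_bound (C := K ^ n)
      ((measurable_uncurry_mpDev).pow_const n).aestronglyMeasurable ?_
    have h1 : ∀ᵐ p : (Fin m → ℝ) × ℝ ∂(μ.prod (volume.restrict (Ioc A B))), p.2 ∈ Ioc A B := by
      refine Measure.quasiMeasurePreserving_snd.ae ?_
      exact ae_restrict_mem measurableSet_Ioc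
    filter_upwards [h1] with p hp
    simp only [uncurry]
    rw [norm_pow, Real.norm_of_nonneg (mpDev_nonneg _ _)]
    exact pow_le_pow_left₀ (mpDev_nonneg _ _) (hK _ _ (hJ (Ioc_subset_Icc_self hp))) n
  have hIoc : ∀ x : Fin m → ℝ, ∫ E in A..B, mpDev d η x E ^ n = ∫ E in Ioc A B, mpDev d η x E ^ n :=
    fun x => intervalIntegral.integral_of_le hAB.le
  have hfi : Integrable (fun x : Fin m → ℝ => ∫ E in A..B, mpDev d η x E ^ n) μ := by
    simp only [hIoc]
    exact hprod.integral_prod_left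
  have hf0 : ∀ x : Fin m → ℝ, 0 ≤ ∫ E in A..B, mpDev d η x E ^ n := fun x =>
    intervalIntegral.integral_nonneg hAB.le fun E _ => pow_nonneg (mpDev_nonneg x E) n
  have hmk := mul_meas_ge_le_integral_of_nonneg (Eventually.of_forall hf0) hfi
    ((γ / 2) ^ n * (B - A))
  have hswap : ∫ x, (∫ E in A..B, mpDev d η x E ^ n) ∂μ ≤ (B - A) * (C * U) := by
    simp only [hIoc]
    rw [integral_integral_swap hprod]
    calc _ ≤ ∫ _E in Ioc A B, C * U := by
          refine setIntegral_mono_on hprod.integral_prod_right (integrable_const _) measurableSet_Ioc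
            fun E hE => ?_
          exact hmom m hm η hη hη1 ht E (hJ (Ioc_subset_Icc_self hE))
      _ = _ := by
          rw [setIntegral_const, smul_eq_mul]
          simp [hBA.le]
  have hmono := measureReal_mono (μ := μ) hsub
  refine hmono.trans ?_
  set p := μ.real {x | (γ / 2) ^ n * (B - A) ≤ ∫ E in A..B, mpDev d η x E ^ n}
  have h5 : (γ / 2) ^ n * (B - A) * p ≤ (B - A) * (C * U) := hmk.trans hswap
  have h6 : (γ / 2) ^ n * p ≤ C * U := by
    refine le_of_mul_le_mul_left ?_ hBA
    linarith
  calc p = (2 / γ) ^ n * ((γ / 2) ^ n * p) := by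
        rw [← mul_assoc, ← mul_pow]
        have : 2 / γ * (γ / 2) = 1 := by field_simp
        rw [this, one_pow, one_mul]
    _ ≤ (2 / γ) ^ n * (C * U) := by gcongr
    _ = _ := by ring

end

/-! ### Counting points with the Poisson kernel -/

section

variable {m : ℕ} {d η : ℝ}

theorem im_empStieltjes (hd : 0 < d) (hm : 0 < m) (E η : ℝ) (x : Fin m → ℝ) :
    (empStieltjes d (E + η * Complex.I) x).im
      = (∑ i, η / ((d / m * x i - E) ^ 2 + η ^ 2)) / m := by
  have hm' : (0 : ℝ) < m := by exact_mod_cast hm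
  rw [empStieltjes, Complex.div_ofReal_im, resolventTrace, Complex.im_sum, Finset.sum_div,
    Finset.sum_div]
  refine Finset.sum_congr rfl fun i _ => ?_
  rw [Complex.inv_im, Complex.normSq_apply, Complex.sub_im, Complex.sub_re, Complex.re_ofReal_mul,
    Complex.im_ofReal_mul]
  simp only [Complex.ofReal_re, Complex.ofReal_im, im_energy]
  have hre : ((E : ℂ) + η * Complex.I).re = E := by simp
  rw [hre]
  have e : (x i - m / d * E) * (x i - m / d * E) + (0 - m / d * η) * (0 - m / d * η)
      = (m / d) ^ 2 * ((d / m * x i - E) ^ 2 + η ^ 2) := by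
    field_simp
    ring
  rw [e]
  rcases eq_or_ne ((d / m * x i - E) ^ 2 + η ^ 2) 0 with h | h
  · rw [h]; simp
  · field_simp
    ring

theorem integral_poisson (hη : 0 < η) (y A B : ℝ) :
    ∫ E in A..B, η / ((y - E) ^ 2 + η ^ 2)
      = Real.arctan ((B - y) / η) - Real.arctan ((A - y) / η) := by
  refine intervalIntegral.integral_eq_sub_of_hasDerivAt
    (f := fun E => Real.arctan ((E - y) / η)) (fun E _ => ?_) ?_
  · have h := (((hasDerivAt_id E).sub_const y).div_const η).arctan
    refine h.congr_deriv ?_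
    simp only [id]
    have : (y - E) ^ 2 + η ^ 2 ≠ 0 := by positivity
    have h2 : 1 + ((E - y) / η) ^ 2 = ((y - E) ^ 2 + η ^ 2) / η ^ 2 := by
      field_simp
      ring
    rw [h2]
    field_simp
  · refine Continuous.intervalIntegrable ?_ _ _
    exact continuous_const.div (by fun_prop) fun E => by positivity

theorem continuous_poisson (hη : 0 < η) (y : ℝ) :
    Continuous fun E => η / ((y - E) ^ 2 + η ^ 2) :=
  continuous_const.div (by fun_prop) fun E => by positivity

theorem pi_div_two_sub_le_arctan {u : ℝ} (hu : 0 < u) : Real.pi / 2 - 1 / u ≤ Real.arctan u := by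
  have h := Real.arctan_inv_of_pos hu
  have h1 : Real.arctan u⁻¹ ≤ u⁻¹ := by
    have h2 := Real.le_tan (Real.arctan_nonneg.2 (inv_pos.2 hu).le) (Real.arctan_lt_pi_div_two _)
    rwa [Real.tan_arctan] at h2
  rw [one_div]
  linarith

theorem le_integral_poisson (hη : 0 < η) {w y A B : ℝ} (hw : 0 < w) (hy : y ∈ Icc A B) :
    Real.pi - 2 * η / w ≤ ∫ E in (A - w)..(B + w), η / ((y - E) ^ 2 + η ^ 2) := by
  rw [integral_poisson hη]
  have h0 := pi_div_two_sub_le_arctan (u := w / η) (by positivity)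
  have h1 : Real.arctan (w / η) ≤ Real.arctan ((B + w - y) / η) :=
    Real.arctan_strictMono.monotone (by gcongr; linarith [hy.2])
  have h2 : Real.arctan ((A - w - y) / η) ≤ -Real.arctan (w / η) := by
    rw [← Real.arctan_neg, ← neg_div]
    exact Real.arctan_strictMono.monotone (by gcongr; linarith [hy.1])
  rw [one_div_div] at h0
  have : 2 * η / w = 2 * (η / w) := by ring
  linarith

theorem integral_poisson_le_pi (hη : 0 < η) (y A B : ℝ) :
    ∫ E in A..B, η / ((y - E) ^ 2 + η ^ 2) ≤ Real.pi := by
  rw [integral_poisson hη]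
  linarith [Real.arctan_lt_pi_div_two ((B - y) / η), Real.neg_pi_div_two_lt_arctan ((A - y) / η)]

theorem integral_poisson_nonneg (hη : 0 < η) (y : ℝ) {A B : ℝ} (hAB : A ≤ B) :
    0 ≤ ∫ E in A..B, η / ((y - E) ^ 2 + η ^ 2) :=
  intervalIntegral.integral_nonneg hAB fun E _ => by positivity

/-- The tail of the Poisson kernel at scale `η` is bounded by the kernel at a larger scale `η'`,
with a gain of `η / η'`. -/
theorem integral_poisson_tail_le {η' w y A B : ℝ} (hη : 0 < η) (hη' : 0 < η')
    (hw : η' ≤ w) (hAB : A + w ≤ B - w) (hy : y ∉ Icc A B) :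
    ∫ E in (A + w)..(B - w), η / ((y - E) ^ 2 + η ^ 2)
      ≤ 2 * (η / η') * ∫ E in (A + w)..(B - w), η' / ((y - E) ^ 2 + η' ^ 2) := by
  rw [← intervalIntegral.integral_const_mul]
  refine intervalIntegral.integral_mono_on hAB ((continuous_poisson hη y).intervalIntegrable _ _)
    (((continuous_poisson hη' y).const_mul _).intervalIntegrable _ _) fun E hE => ?_
  have hu : η' ^ 2 ≤ (y - E) ^ 2 := by
    rw [mem_Icc, not_and_or, not_le, not_le] at hy
    rcases hy with h | h
    · nlinarith [hE.1]
    · nlinarith [hE.2]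
  have hpos : 0 < (y - E) ^ 2 := lt_of_lt_of_le (by positivity) hu
  have e : 2 * (η / η') * (η' / ((y - E) ^ 2 + η' ^ 2)) = 2 * η / ((y - E) ^ 2 + η' ^ 2) := by
    field_simp
  rw [e, div_le_div_iff₀ (by positivity) (by positivity)]
  nlinarith [mul_le_mul_of_nonneg_left hu hη.le, sq_nonneg η, mul_pos hη (pow_pos hη 2)]

open Classical in
theorem rescaledCount_eq_sum (d : ℝ) (x : Fin m → ℝ) (I : Set ℝ) :
    (rescaledCount m d x I : ℝ) = ∑ i, if d / (m : ℝ) * x i ∈ I then (1 : ℝ) else 0 := by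
  rw [rescaledCount, Nat.card_eq_fintype_card, Fintype.card_subtype, Finset.sum_boole]

theorem integral_im_empStieltjes (hd : 0 < d) (hm : 0 < m) (hη : 0 < η) (x : Fin m → ℝ) (A B : ℝ) :
    ∫ E in A..B, (empStieltjes d (E + η * Complex.I) x).im
      = (∑ i, ∫ E in A..B, η / ((d / m * x i - E) ^ 2 + η ^ 2)) / m := by
  simp only [im_empStieltjes hd hm]
  rw [intervalIntegral.integral_div, intervalIntegral.integral_finsetSum]
  exact fun i _ => (continuous_poisson hη _).intervalIntegrable _ _

/-- Smoothing over an enlarged interval captures almost all of the weight `π` of each point. -/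
theorem count_mul_le (hd : 0 < d) (hm : 0 < m) (hη : 0 < η) {w A B : ℝ} (hw : 0 < w) (hAB : A ≤ B)
    (x : Fin m → ℝ) :
    (rescaledCount m d x (Icc A B) : ℝ) / m * (Real.pi - 2 * η / w)
      ≤ ∫ E in (A - w)..(B + w), (empStieltjes d (E + η * Complex.I) x).im := by
  classical
  rw [integral_im_empStieltjes hd hm hη, rescaledCount_eq_sum, div_mul_eq_mul_div, Finset.sum_mul]
  gcongr with i
  split_ifs with h
  · rw [one_mul]
    exact le_integral_poisson hη hw h
  · rw [zero_mul]
    exact integral_poisson_nonneg hη _ (by linarith)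

/-- Smoothing over a shrunk interval sees each point of `[A, B]` with weight at most `π`; the other
points contribute through the tail of the kernel only. -/
theorem integral_le_count (hd : 0 < d) (hm : 0 < m) {η' w A B : ℝ} (hη : 0 < η) (hη' : 0 < η')
    (hw : η' ≤ w) (hAB : A + w ≤ B - w) (x : Fin m → ℝ) :
    ∫ E in (A + w)..(B - w), (empStieltjes d (E + η * Complex.I) x).im
      ≤ Real.pi * ((rescaledCount m d x (Icc A B) : ℝ) / m)
        + 2 * (η / η') * ∫ E in (A + w)..(B - w), (empStieltjes d (E + η' * Complex.I) x).im := by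
  classical
  rw [integral_im_empStieltjes hd hm hη, integral_im_empStieltjes hd hm hη', rescaledCount_eq_sum,
    ← mul_div_assoc, ← mul_div_assoc, ← add_div, Finset.mul_sum, Finset.mul_sum,
    ← Finset.sum_add_distrib]
  gcongr with i
  have h0 := integral_poisson_nonneg hη' (d / m * x i) hAB
  split_ifs with h
  · have h1 := integral_poisson_le_pi hη (d / m * x i) (A + w) (B - w)
    have : 0 ≤ 2 * (η / η') * ∫ E in (A + w)..(B - w), η' / ((d / m * x i - E) ^ 2 + η' ^ 2) := by
      positivity
    linarith
  · rw [mul_zero, zero_add]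
    exact integral_poisson_tail_le hη hη' hw hAB h

theorem continuous_im_empStieltjes_energy (hd : 0 < d) (hm : 0 < m) (hη : 0 < η) (x : Fin m → ℝ) :
    Continuous fun E : ℝ => (empStieltjes d (E + η * Complex.I) x).im := by
  simp only [im_empStieltjes hd hm]
  exact (continuous_finsetSum _ fun i _ => continuous_poisson hη _).div_const _

theorem intervalIntegrable_mpDensity (hd : 0 < d) (hd1 : d ≤ 1) {κ : ℝ} (hκ : 0 < κ) {A B : ℝ}
    (hAB : A ≤ B) (hJ : Icc A B ⊆ mpBulk d κ) : IntervalIntegrable (mpDensity d) volume A B := by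
  obtain ⟨M, -, hM⟩ := exists_mpDensity_le hd hd1 hκ
  rw [intervalIntegrable_iff_integrableOn_Ioc_of_le hAB]
  refine Measure.integrableOn_of_bounded (M := M) (by simp)
    measurable_mpDensity.aestronglyMeasurable ?_
  refine (ae_restrict_iff' measurableSet_Ioc).2 (Eventually.of_forall fun E hE => ?_)
  rw [Real.norm_of_nonneg (mpDensity_nonneg hd E)]
  exact hM E (hJ (Ioc_subset_Icc_self hE))

theorem abs_integral_im_sub_le (hd : 0 < d) (hd1 : d ≤ 1) {κ : ℝ} (hκ : 0 < κ) (hm : 0 < m)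
    (hη : 0 < η) (x : Fin m → ℝ) {A B : ℝ} (hAB : A ≤ B) (hJ : Icc A B ⊆ mpBulk d κ) :
    |(∫ E in A..B, (empStieltjes d (E + η * Complex.I) x).im)
        - Real.pi * ∫ E in A..B, mpDensity d E| ≤ ∫ E in A..B, mpDev d η x E := by
  have h1 := (continuous_im_empStieltjes_energy hd hm hη x).intervalIntegrable (μ := volume) A B
  have h2 := intervalIntegrable_mpDensity hd hd1 hκ hAB hJ
  rw [← intervalIntegral.integral_const_mul, ← intervalIntegral.integral_sub h1 (h2.const_mul _)]
  exact intervalIntegral.abs_integral_le_integral_abs hAB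

theorem integral_mpDensity_le {M A B : ℝ} (hAB : A ≤ B)
    (hi : IntervalIntegrable (mpDensity d) volume A B) (hM : ∀ E ∈ Icc A B, mpDensity d E ≤ M) :
    ∫ E in A..B, mpDensity d E ≤ M * (B - A) := by
  have := intervalIntegral.integral_mono_on hAB hi intervalIntegrable_const hM
  rwa [intervalIntegral.integral_const, smul_eq_mul, mul_comm] at this

/-- Upper bound on the relative number `n` of points: `I` is the smoothed count on the larger
interval, `P` its Marchenko-Pastur mass, `R` the mass of the interval itself. -/
theorem count_sub_lt_of_smoothed {n R M δ ℓ ρ h P I G : ℝ} (hn0 : 0 ≤ n) (hM : 0 < M) (hδ : 0 < δ)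
    (hℓ : 0 < ℓ) (hρ : 0 < ρ) (hρ1 : ρ ≤ 1 / 2) (hρ2 : ρ * (M + 1) ≤ δ / 100) (hh : 0 ≤ h)
    (hhρ : h ≤ 2 * ρ) (hnI : n * (Real.pi - h) ≤ I) (hI : I ≤ Real.pi * P + G)
    (hG : G ≤ δ / 16 * (2 * ℓ)) (hG2 : G ≤ 2 * ℓ) (hP : P ≤ R + δ / 32 * ℓ) (hP2 : P ≤ 2 * M * ℓ)
    (hP0 : 0 ≤ P) : n - R < δ * ℓ := by
  have hpi3 := Real.pi_gt_three
  have hpi4 := Real.pi_le_four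
  have hn1 : n ≤ (8 * M + 2) * ℓ := by
    have q1 : n * 2 ≤ n * (Real.pi - h) := by gcongr; linarith
    have q2 : Real.pi * P ≤ 4 * (2 * M * ℓ) := mul_le_mul hpi4 hP2 hP0 (by norm_num)
    linarith
  have hn2 : n * h ≤ (8 * M + 2) * ℓ * (2 * ρ) := mul_le_mul hn1 hhρ hh (by positivity)
  have hn3 : (8 * M + 2) * ℓ * (2 * ρ) ≤ 16 * (δ / 100) * ℓ := by
    calc (8 * M + 2) * ℓ * (2 * ρ) ≤ (8 * M + 8) * ℓ * (2 * ρ) := by gcongr; norm_num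
      _ = 16 * (ρ * (M + 1)) * ℓ := by ring
      _ ≤ _ := by gcongr
  have q5 : Real.pi * P ≤ Real.pi * (R + δ / 32 * ℓ) := by gcongr
  have hδℓ : 0 < δ * ℓ := by positivity
  have q7 : 3 * (δ * ℓ) ≤ Real.pi * (δ * ℓ) := by gcongr
  have q8 : Real.pi * (n - R) ≤ Real.pi * (δ / 32 * ℓ + δ / 2 * ℓ) := by linarith
  have q9 := le_of_mul_le_mul_left q8 (by positivity)
  linarith

/-- Lower bound on the relative number `n` of points: `I₁`, `I₂` are the smoothed counts on the
smaller interval at the two scales, `P` its Marchenko-Pastur mass, `R` the mass of the interval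
itself. -/
theorem sub_count_lt_of_smoothed {n R M δ ℓ ρ P I₁ I₂ G : ℝ} (hδ : 0 < δ)
    (hℓ : 0 < ℓ) (hρ : 0 < ρ) (hρ2 : ρ * (M + 1) ≤ δ / 100)
    (hI : I₁ ≤ Real.pi * n + 2 * ρ * I₂) (hI₂ : I₂ ≤ Real.pi * P + G) (hI₁ : Real.pi * P - G ≤ I₁)
    (hG : G ≤ δ / 16 * ℓ) (hG2 : G ≤ ℓ) (hP : R - δ / 32 * ℓ ≤ P) (hP2 : P ≤ M * ℓ)
    (hP0 : 0 ≤ P) : R - n < δ * ℓ := by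
  have hpi3 := Real.pi_gt_three
  have hpi4 := Real.pi_le_four
  have q1 : I₂ ≤ (4 * M + 1) * ℓ := by
    have q2 : Real.pi * P ≤ 4 * (M * ℓ) := mul_le_mul hpi4 hP2 hP0 (by norm_num)
    linarith
  have q2 : 2 * ρ * I₂ ≤ 2 * ρ * ((4 * M + 1) * ℓ) := by gcongr
  have q3 : 2 * ρ * ((4 * M + 1) * ℓ) ≤ 8 * (δ / 100) * ℓ := by
    calc 2 * ρ * ((4 * M + 1) * ℓ) ≤ 2 * ρ * ((4 * M + 4) * ℓ) := by gcongr; norm_num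
      _ = 8 * (ρ * (M + 1)) * ℓ := by ring
      _ ≤ _ := by gcongr
  have q5 : Real.pi * (R - δ / 32 * ℓ) ≤ Real.pi * P := by gcongr
  have hδℓ : 0 < δ * ℓ := by positivity
  have q7 : 3 * (δ * ℓ) ≤ Real.pi * (δ * ℓ) := by gcongr
  have q8 : Real.pi * (R - n) ≤ Real.pi * (δ / 32 * ℓ + δ / 2 * ℓ) := by linarith
  have q9 := le_of_mul_le_mul_left q8 (by positivity)
  linarith

/-- Comparison of the number of points in an interval of the bulk with the Marchenko-Pastur mass,
given control of the averaged deviation at two scales `η₁ ≪ η₂` on a slightly larger and a slightly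
smaller interval. -/
theorem exists_abs_count_sub_lt (hd : 0 < d) (hd1 : d ≤ 1) {κ δ : ℝ} (hκ : 0 < κ) (hδ : 0 < δ) :
    ∃ θ γ r : ℝ, 0 < θ ∧ 0 < γ ∧ 0 < r ∧ ∀ m : ℕ, 0 < m → ∀ (x : Fin m → ℝ) (A B η₁ η₂ : ℝ),
      A < B → Icc A B ⊆ mpBulk d κ → 0 < η₁ → 0 < η₂ → η₂ ≤ θ * (B - A) → η₁ / η₂ ≤ r →
      A + θ * (B - A) < B - θ * (B - A) ∧
      Icc (A - θ * (B - A)) (B + θ * (B - A)) ⊆ mpBulk d (κ / 2) ∧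
      (∫ E in (A - θ * (B - A))..(B + θ * (B - A)), mpDev d η₁ x E
        < γ * (B + θ * (B - A) - (A - θ * (B - A))) →
      ∫ E in (A + θ * (B - A))..(B - θ * (B - A)), mpDev d η₁ x E
        < γ * (B - θ * (B - A) - (A + θ * (B - A))) →
      ∫ E in (A + θ * (B - A))..(B - θ * (B - A)), mpDev d η₂ x E
        < γ * (B - θ * (B - A) - (A + θ * (B - A))) →
      |(rescaledCount m d x (Icc A B) : ℝ) / m - ∫ E in A..B, mpDensity d E| < δ * (B - A)) := by
  obtain ⟨M, hM, hM'⟩ := exists_mpDensity_le hd hd1 (half_pos hκ)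
  refine ⟨min (min (1 / 4) (κ / 8)) (δ / (64 * M)), min 1 (δ / 16),
    min (1 / 2) (δ / (100 * (M + 1))), by positivity, by positivity, by positivity,
    fun m hm x A B η₁ η₂ hAB hJ hη₁ hη₂ hη₂θ hr => ?_⟩
  set θ := min (min (1 / 4) (κ / 8)) (δ / (64 * M)) with hθ
  set γ := min 1 (δ / 16) with hγ
  have hθ0 : 0 < θ := by positivity
  have hγ0 : 0 < γ := by positivity
  have hθ1 : θ ≤ 1 / 4 := (min_le_left _ _).trans (min_le_left _ _)
  have hθ2 : θ ≤ κ / 8 := (min_le_left _ _).trans (min_le_right _ _)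
  have hθ3 : θ * M ≤ δ / 64 := by
    have : θ ≤ δ / (64 * M) := min_le_right _ _
    rw [le_div_iff₀ (by positivity)] at this
    linarith
  have hγ1 : γ ≤ 1 := min_le_left _ _
  have hγ2 : γ ≤ δ / 16 := min_le_right _ _
  have hr1 : η₁ / η₂ ≤ 1 / 2 := hr.trans (min_le_left _ _)
  have hr2 : η₁ / η₂ * (M + 1) ≤ δ / 100 := by
    have := hr.trans (min_le_right _ _)
    rw [le_div_iff₀ (by positivity)] at this
    linarith
  set ℓ := B - A with hℓ
  have hℓ0 : 0 < ℓ := by linarith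
  have hA := hJ (left_mem_Icc.2 hAB.le)
  have hB := hJ (right_mem_Icc.2 hAB.le)
  have hℓ4 : ℓ ≤ 4 := by
    linarith [(mem_mpBulk_bounds hd1 hA).1, (mem_mpBulk_bounds hd1 hB).2]
  set w := θ * ℓ with hw
  have hw0 : 0 < w := by positivity
  have hw1 : w ≤ ℓ / 4 := by nlinarith
  have hw2 : w ≤ κ / 2 := by nlinarith
  have hsub : Icc (A - w) (B + w) ⊆ mpBulk d (κ / 2) := fun E hE =>
    ⟨by linarith [hE.1, hA.1], by linarith [hE.2, hB.2]⟩
  refine ⟨by linarith, hsub, fun d1 d2 d3 => ?_⟩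
  have hκ2 := half_pos hκ
  have s1 : Icc A B ⊆ Icc (A - w) (B + w) := Icc_subset_Icc (by linarith) (by linarith)
  have s2 : Icc (A + w) (B - w) ⊆ Icc (A - w) (B + w) := Icc_subset_Icc (by linarith) (by linarith)
  have s3 : Icc (A - w) A ⊆ Icc (A - w) (B + w) := Icc_subset_Icc (by linarith) (by linarith)
  have s4 : Icc B (B + w) ⊆ Icc (A - w) (B + w) := Icc_subset_Icc (by linarith) (by linarith)
  have s5 : Icc A (A + w) ⊆ Icc (A - w) (B + w) := Icc_subset_Icc (by linarith) (by linarith)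
  have s6 : Icc (B - w) B ⊆ Icc (A - w) (B + w) := Icc_subset_Icc (by linarith) (by linarith)
  have i0 := intervalIntegrable_mpDensity hd hd1 hκ2 (by linarith) hsub
  have i1 := intervalIntegrable_mpDensity hd hd1 hκ2 hAB.le (s1.trans hsub)
  have i2 := intervalIntegrable_mpDensity hd hd1 hκ2 (by linarith) (s2.trans hsub)
  have i3 := intervalIntegrable_mpDensity hd hd1 hκ2 (by linarith) (s3.trans hsub)
  have i4 := intervalIntegrable_mpDensity hd hd1 hκ2 (by linarith) (s4.trans hsub)
  have i5 := intervalIntegrable_mpDensity hd hd1 hκ2 (by linarith) (s5.trans hsub)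
  have i6 := intervalIntegrable_mpDensity hd hd1 hκ2 (by linarith) (s6.trans hsub)
  have b0 := integral_mpDensity_le (by linarith) i0 fun E hE => hM' E (hsub hE)
  have b2 := integral_mpDensity_le (by linarith) i2 fun E hE => hM' E (hsub (s2 hE))
  have b3 := integral_mpDensity_le (by linarith) i3 fun E hE => hM' E (hsub (s3 hE))
  have b4 := integral_mpDensity_le (by linarith) i4 fun E hE => hM' E (hsub (s4 hE))
  have b5 := integral_mpDensity_le (by linarith) i5 fun E hE => hM' E (hsub (s5 hE))
  have b6 := integral_mpDensity_le (by linarith) i6 fun E hE => hM' E (hsub (s6 hE))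
  have c1 : ∫ E in (A - w)..(B + w), mpDensity d E = (∫ E in (A - w)..A, mpDensity d E)
      + (∫ E in A..B, mpDensity d E) + ∫ E in B..(B + w), mpDensity d E := by
    rw [intervalIntegral.integral_add_adjacent_intervals i3 i1,
      intervalIntegral.integral_add_adjacent_intervals (i3.trans i1) i4]
  have c2 : ∫ E in A..B, mpDensity d E = (∫ E in A..(A + w), mpDensity d E)
      + (∫ E in (A + w)..(B - w), mpDensity d E) + ∫ E in (B - w)..B, mpDensity d E := by
    rw [intervalIntegral.integral_add_adjacent_intervals i5 i2,
      intervalIntegral.integral_add_adjacent_intervals (i5.trans i2) i6]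
  have e1 := abs_le.1 (abs_integral_im_sub_le hd hd1 hκ2 hm hη₁ x (by linarith) hsub)
  have e2 := abs_le.1 (abs_integral_im_sub_le hd hd1 hκ2 hm hη₁ x (by linarith) (s2.trans hsub))
  have e3 := abs_le.1 (abs_integral_im_sub_le hd hd1 hκ2 hm hη₂ x (by linarith) (s2.trans hsub))
  have k1 := count_mul_le hd hm hη₁ hw0 hAB.le x
  have k2 := integral_le_count hd hm hη₁ hη₂ hη₂θ (by linarith) x (A := A) (B := B)
  set n : ℝ := (rescaledCount m d x (Icc A B) : ℝ) / m with hn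
  have hn0 : 0 ≤ n := by positivity
  set R := ∫ E in A..B, mpDensity d E
  set ρ := η₁ / η₂ with hρ
  have hρ0 : 0 < ρ := by positivity
  have hηw : 2 * η₁ / w ≤ 2 * ρ := by
    rw [hρ, ← mul_div_assoc]
    gcongr
  have hwM : M * w ≤ δ / 64 * ℓ := by
    calc M * w = θ * M * ℓ := by rw [hw]; ring
      _ ≤ _ := by gcongr
  have g1 : γ * (B - w - (A + w)) ≤ γ * ℓ := by gcongr; linarith
  have g2 : γ * (B + w - (A - w)) ≤ γ * (2 * ℓ) := by gcongr; linarith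
  have g3 : γ * ℓ ≤ 1 * ℓ := by gcongr
  have g4 : γ * ℓ ≤ δ / 16 * ℓ := by gcongr
  have g5 : M * (B + w - (A - w)) ≤ M * (2 * ℓ) := by gcongr; linarith
  have g6 : M * (B - w - (A + w)) ≤ M * ℓ := by gcongr; linarith
  rw [abs_lt]
  constructor
  · have := sub_count_lt_of_smoothed hδ hℓ0 hρ0 hr2 k2 (G := γ * ℓ)
      (P := ∫ E in (A + w)..(B - w), mpDensity d E) (R := R)
      (by linarith only [e3.2, d3, g1]) (by linarith only [e2.1, d2, g1]) g4
      (by linarith only [g3]) (by linarith only [c2, b5, b6, hwM]) (b2.trans g6)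
      (intervalIntegral.integral_nonneg (by linarith) fun E _ => mpDensity_nonneg hd E)
    linarith only [this]
  · exact count_sub_lt_of_smoothed hn0 hM hδ hℓ0 hρ0 hr1 hr2 (by positivity) hηw k1
      (P := ∫ E in (A - w)..(B + w), mpDensity d E) (G := γ * (2 * ℓ))
      (by linarith only [e1.2, d1, g2]) (by linarith only [g4]) (by linarith only [g3])
      (by linarith only [c1, b3, b4, hwM]) (by linarith only [b0, g5])
      (intervalIntegral.integral_nonneg (by linarith) fun E _ => mpDensity_nonneg hd E)

end

/-! ### Total mass of the Marchenko-Pastur law -/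

section

variable {d : ℝ}

/-- An antiderivative of `√((λ₊ - x) (x - λ₋)) / x`. For `d = 1` its last term vanishes, so the
junk value of the quotient at `x = 0` is harmless. -/
noncomputable def mpPrimitive (d x : ℝ) : ℝ :=
  √((mpUpper d - x) * (x - mpLower d)) + (1 + d) * Real.arcsin ((x - 1 - d) / (2 * √d))
    - (1 - d) * Real.arcsin (((1 + d) * x - (1 - d) ^ 2) / (2 * √d * x))

theorem mpUpper_sub_mul_sub_mpLower' (hd : 0 ≤ d) (x : ℝ) :
    (mpUpper d - x) * (x - mpLower d) = 4 * d - (x - 1 - d) ^ 2 := by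
  rw [mpUpper_sub_mul_sub_mpLower hd]
  ring

theorem hasDerivAt_mpPrimitive (hd : 0 < d) (hd1 : d ≤ 1) {x : ℝ}
    (hx : x ∈ Ioo (mpLower d) (mpUpper d)) :
    HasDerivAt (mpPrimitive d) (√((mpUpper d - x) * (x - mpLower d)) / x) x := by
  have hx0 : 0 < x := mpLower_nonneg.trans_lt hx.1
  have hs0 : 0 < √d := Real.sqrt_pos.2 hd
  have hs2 : √d ^ 2 = d := Real.sq_sqrt hd.le
  have hpos : 0 < (mpUpper d - x) * (x - mpLower d) :=
    mul_pos (by linarith [hx.2]) (by linarith [hx.1])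
  set R := √((mpUpper d - x) * (x - mpLower d)) with hR
  have hR0 : 0 < R := Real.sqrt_pos.2 hpos
  have hR2 : R ^ 2 = 4 * d - (x - 1 - d) ^ 2 := by
    rw [hR, Real.sq_sqrt hpos.le, mpUpper_sub_mul_sub_mpLower' hd.le]
  have h1 : HasDerivAt (fun x => √((mpUpper d - x) * (x - mpLower d))) ((1 + d - x) / R) x := by
    have h := (((hasDerivAt_id x).const_sub (mpUpper d)).mul
      ((hasDerivAt_id x).sub_const (mpLower d))).sqrt hpos.ne'
    refine h.congr_deriv ?_
    have e : -1 * (x - mpLower d) + (mpUpper d - x) * 1 = 2 * (1 + d - x) := by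
      unfold mpLower mpUpper
      nlinarith
    simp only [id, Pi.mul_apply] at *
    rw [e, ← hR]
    field_simp
  have h2 : HasDerivAt (fun x => (1 + d) * Real.arcsin ((x - 1 - d) / (2 * √d)))
      ((1 + d) / R) x := by
    set u := (x - 1 - d) / (2 * √d) with hu
    have hu2 : 1 - u ^ 2 = (R / (2 * √d)) ^ 2 := by
      rw [hu, div_pow, div_pow, hR2, mul_pow, hs2]
      field_simp
      ring
    have hup : 0 < 1 - u ^ 2 := by rw [hu2]; positivity
    have h := ((Real.hasDerivAt_arcsin (x := u) (fun h => by rw [h] at hup; norm_num at hup)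
      (fun h => by rw [h] at hup; norm_num at hup)).comp x
      ((((hasDerivAt_id x).sub_const 1).sub_const d).div_const (2 * √d))).const_mul (1 + d)
    refine h.congr_deriv ?_
    rw [hu2, Real.sqrt_sq (by positivity)]
    field_simp
  have h3 : HasDerivAt
      (fun x => (1 - d) * Real.arcsin (((1 + d) * x - (1 - d) ^ 2) / (2 * √d * x)))
      ((1 - d) ^ 2 / (x * R)) x := by
    rcases eq_or_lt_of_le hd1 with h1' | h1'
    · subst h1'
      simpa using hasDerivAt_const x (0 : ℝ)
    have hd1' : 0 < 1 - d := by linarith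
    set u := ((1 + d) * x - (1 - d) ^ 2) / (2 * √d * x) with hu
    have hu2 : 1 - u ^ 2 = ((1 - d) * R / (2 * √d * x)) ^ 2 := by
      rw [hu, div_pow, div_pow, mul_pow (1 - d) R, hR2, mul_pow, mul_pow, hs2]
      field_simp
      ring
    have hup : 0 < 1 - u ^ 2 := by rw [hu2]; positivity
    have h := (Real.hasDerivAt_arcsin (x := u) (fun h => by rw [h] at hup; norm_num at hup)
      (fun h => by rw [h] at hup; norm_num at hup)).comp x
      ((((hasDerivAt_id x).const_mul (1 + d)).sub_const ((1 - d) ^ 2)).div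
        ((hasDerivAt_id x).const_mul (2 * √d)) (by change 2 * √d * x ≠ 0; positivity))
    have h4 := h.const_mul (1 - d)
    refine h4.congr_deriv ?_
    simp only [id]
    rw [hu2, Real.sqrt_sq (by positivity)]
    field_simp
    ring
  refine ((h1.add h2).sub h3).congr_deriv ?_
  field_simp
  rw [hR2]
  ring

theorem continuousOn_mpPrimitive (hd : 0 < d) (hd1 : d ≤ 1) :
    ContinuousOn (mpPrimitive d) (Icc (mpLower d) (mpUpper d)) := by
  have hs0 : 0 < √d := Real.sqrt_pos.2 hd
  refine ContinuousOn.sub (Continuous.continuousOn ?_) ?_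
  · exact (by fun_prop : Continuous fun x => √((mpUpper d - x) * (x - mpLower d))).add
      (continuous_const.mul (Real.continuous_arcsin.comp (by fun_prop)))
  · rcases eq_or_lt_of_le hd1 with h1' | h1'
    · subst h1'
      simpa using continuousOn_const
    · have h1 : 0 < mpLower d := by
        have : √d < 1 := by rw [Real.sqrt_lt' one_pos]; simpa using h1'
        exact pow_pos (by linarith) 2
      refine continuousOn_const.mul (Real.continuous_arcsin.comp_continuousOn ?_)
      refine ContinuousOn.div (by fun_prop) (by fun_prop) fun x hx => ?_
      have : 0 < x := h1.trans_le hx.1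
      positivity

theorem mpPrimitive_upper_sub_lower (hd : 0 < d) (hd1 : d ≤ 1) :
    mpPrimitive d (mpUpper d) - mpPrimitive d (mpLower d) = 2 * Real.pi * d := by
  have hs0 : 0 < √d := Real.sqrt_pos.2 hd
  have hs2 : √d ^ 2 = d := Real.sq_sqrt hd.le
  have e1 : (mpUpper d - 1 - d) / (2 * √d) = 1 := by
    rw [div_eq_one_iff_eq (by positivity), mpUpper]
    nlinarith
  have e2 : (mpLower d - 1 - d) / (2 * √d) = -1 := by
    rw [div_eq_iff (by positivity), mpLower]
    nlinarith
  have e3 : ((1 + d) * mpUpper d - (1 - d) ^ 2) / (2 * √d * mpUpper d) = 1 := by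
    have h : 0 < mpUpper d := by unfold mpUpper; positivity
    rw [div_eq_one_iff_eq (by positivity), mpUpper, ← hs2, Real.sqrt_sq hs0.le]
    ring
  have e4 : (1 - d) * Real.arcsin (((1 + d) * mpLower d - (1 - d) ^ 2) / (2 * √d * mpLower d))
      = (1 - d) * -(Real.pi / 2) := by
    rcases eq_or_lt_of_le hd1 with h1' | h1'
    · subst h1'
      simp
    · have h1 : 0 < mpLower d := by
        have : √d < 1 := by rw [Real.sqrt_lt' one_pos]; simpa using h1'
        exact pow_pos (by linarith) 2
      have : ((1 + d) * mpLower d - (1 - d) ^ 2) / (2 * √d * mpLower d) = -1 := by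
        rw [div_eq_iff (by positivity), mpLower, ← hs2, Real.sqrt_sq hs0.le]
        ring
      rw [this, Real.arcsin_neg_one]
  unfold mpPrimitive
  rw [e1, e2, e3, e4]
  simp only [sub_self, zero_mul, mul_zero, Real.sqrt_zero, Real.arcsin_one, Real.arcsin_neg_one]
  ring

theorem mpLower_le_mpUpper : mpLower d ≤ mpUpper d := by
  have := Real.sqrt_nonneg d
  unfold mpLower mpUpper
  nlinarith

theorem integrableOn_mpFormula (hd : 0 < d) (hd1 : d ≤ 1) :
    IntegrableOn (fun x => √((mpUpper d - x) * (x - mpLower d)) / x)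
      (Ioc (mpLower d) (mpUpper d)) :=
  intervalIntegral.integrableOn_deriv_of_nonneg (continuousOn_mpPrimitive hd hd1)
    (fun _ hx => hasDerivAt_mpPrimitive hd hd1 hx)
    fun _ hx => div_nonneg (Real.sqrt_nonneg _) (mpLower_nonneg.trans hx.1.le)

theorem mpDensity_eq_indicator (d : ℝ) :
    mpDensity d = (Icc (mpLower d) (mpUpper d)).indicator
      fun x => 1 / (2 * d * Real.pi) * (√((mpUpper d - x) * (x - mpLower d)) / x) := by
  funext
  unfold mpDensity
  congr 1
  ext x
  rw [mul_comm (1 / (2 * d * Real.pi)), div_mul_div_comm, mul_one, mul_comm, mul_one_div,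
    mul_comm x]

theorem integrable_mpDensity (hd : 0 < d) (hd1 : d ≤ 1) : Integrable (mpDensity d) := by
  rw [mpDensity_eq_indicator d, integrable_indicator_iff measurableSet_Icc,
    integrableOn_Icc_iff_integrableOn_Ioc]
  exact (integrableOn_mpFormula hd hd1).const_mul _

theorem integral_mpDensity (hd : 0 < d) (hd1 : d ≤ 1) :
    ∫ x in (mpLower d)..(mpUpper d), mpDensity d x = 1 := by
  have hpi := Real.pi_pos
  have h1 : ∫ x in (mpLower d)..(mpUpper d), mpDensity d x
      = ∫ x in (mpLower d)..(mpUpper d),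
        1 / (2 * d * Real.pi) * (√((mpUpper d - x) * (x - mpLower d)) / x) := by
    refine intervalIntegral.integral_congr fun x hx => ?_
    rw [uIcc_of_le mpLower_le_mpUpper] at hx
    rw [mpDensity_eq_indicator d, indicator_of_mem hx]
  rw [h1, intervalIntegral.integral_const_mul,
    intervalIntegral.integral_eq_sub_of_hasDerivAt_of_le mpLower_le_mpUpper
    (continuousOn_mpPrimitive hd hd1) (fun _ hx => hasDerivAt_mpPrimitive hd hd1 hx)
    ((intervalIntegrable_iff_integrableOn_Ioc_of_le mpLower_le_mpUpper).2
      (integrableOn_mpFormula hd hd1)), mpPrimitive_upper_sub_lower hd hd1]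
  field_simp

theorem integral_mpDensity_univ (hd : 0 < d) (hd1 : d ≤ 1) : ∫ x, mpDensity d x = 1 := by
  rw [← integral_mpDensity hd hd1, intervalIntegral.integral_of_le mpLower_le_mpUpper,
    ← integral_Icc_eq_integral_Ioc]
  refine (setIntegral_eq_integral_of_forall_compl_eq_zero fun x hx => ?_).symm
  rw [mpDensity, indicator_of_notMem hx]

theorem integral_mpDensity_le_one (hd : 0 < d) (hd1 : d ≤ 1) {A B : ℝ} (hAB : A ≤ B) :
    ∫ x in A..B, mpDensity d x ≤ 1 := by
  rw [intervalIntegral.integral_of_le hAB, ← integral_mpDensity_univ hd hd1]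
  exact setIntegral_le_integral (integrable_mpDensity hd hd1)
    (Eventually.of_forall (mpDensity_nonneg hd))

theorem eventually_lt_integral_mpBulk (hd : 0 < d) (hd1 : d ≤ 1) {c : ℝ} (hc : c < 1) :
    ∀ᶠ κ in 𝓝[>] (0 : ℝ), c < ∫ x in (mpLower d + κ)..(mpUpper d - κ), mpDensity d x := by
  have hi : ∀ a b, IntervalIntegrable (mpDensity d) volume a b := fun a b =>
    (integrable_mpDensity hd hd1).intervalIntegrable
  have hP := intervalIntegral.continuous_primitive hi 0
  have hc' : Continuous fun κ => ∫ x in (mpLower d + κ)..(mpUpper d - κ), mpDensity d x := by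
    have : ∀ κ, ∫ x in (mpLower d + κ)..(mpUpper d - κ), mpDensity d x
        = (∫ x in (0 : ℝ)..(mpUpper d - κ), mpDensity d x)
          - ∫ x in (0 : ℝ)..(mpLower d + κ), mpDensity d x := fun κ =>
      (intervalIntegral.integral_interval_sub_left (hi _ _) (hi _ _)).symm
    simp only [this]
    exact (hP.comp (by fun_prop)).sub (hP.comp (by fun_prop))
  have h0 := hc'.tendsto 0
  simp only [add_zero, sub_zero] at h0
  rw [integral_mpDensity hd hd1] at h0
  exact (h0.mono_left nhdsWithin_le_nhds).eventually (lt_mem_nhds hc)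

end

/-! ### The local law -/

section

variable {β d κ : ℝ}

theorem tendsto_natCast_rpow_neg {s : ℝ} (hs : 0 < s) :
    Tendsto (fun m : ℕ => (m : ℝ) ^ (-s)) atTop (𝓝 0) :=
  (tendsto_rpow_neg_atTop hs).comp tendsto_natCast_atTop_atTop

/-- Local law on all intervals of the bulk that are longer than `m ^ (-1 + ε)`. -/
theorem exists_bulk_law (hβ : 0 < β) (hd : 0 < d) (hd1 : d ≤ 1) (hκ : 0 < κ) {δ ε : ℝ} (hδ : 0 < δ)
    (hε : 0 < ε) (hε1 : ε ≤ 1) (k : ℝ) :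
    ∃ C : ℝ, ∀ᶠ m : ℕ in atTop, ∀ A B : ℝ, Icc A B ⊆ mpBulk d κ → (m : ℝ) ^ (-1 + ε) ≤ B - A →
      (laguerreEnsemble m β (m * β / (2 * d))).real
        {x : Fin m → ℝ | δ * (B - A) ≤
          |(rescaledCount m d x (Icc A B) : ℝ) / m - ∫ t in A..B, mpDensity d t|}
        ≤ C * (m : ℝ) ^ (-k) := by
  obtain ⟨θ, γ, r, hθ, hγ, hr, hdet⟩ := exists_abs_count_sub_lt hd hd1 hκ hδ
  -- the moment bounds at the scales below are of order `(m ^ (-ε / 4)) ^ (2 * q + 2)`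
  set q : ℕ := ⌈4 * k / ε⌉₊ with hq
  obtain ⟨C, t₀, hC, ht₀, hprob⟩ := exists_measure_integral_mpDev_le hβ hd hd1 (half_pos hκ) hγ q
  refine ⟨6 * C, ?_⟩
  have hs := tendsto_natCast_rpow_neg (s := ε / 4) (by positivity)
  have hs2 := tendsto_natCast_rpow_neg (s := ε / 2) (by positivity)
  filter_upwards [hs.eventually (gt_mem_nhds ht₀), hs.eventually (gt_mem_nhds hr),
    hs2.eventually (gt_mem_nhds hθ), eventually_ge_atTop 1] with m hm1 hm2 hm3 hm A B hJ hBA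
  have hm' : (1 : ℝ) ≤ m := by exact_mod_cast hm
  have hm0 : (0 : ℝ) < m := by linarith
  have hmN : 0 < m := hm
  have := isProbabilityMeasure_laguerreEnsemble' m β d hβ hd hd1
  set μ := laguerreEnsemble m β (m * β / (2 * d)) with hμ
  set η₁ : ℝ := (m : ℝ) ^ (-1 + ε / 4) with hη₁
  set η₂ : ℝ := (m : ℝ) ^ (-1 + ε / 2) with hη₂
  set U : ℝ := (m : ℝ) ^ (-(ε / 4)) with hU
  have hη₁0 : 0 < η₁ := Real.rpow_pos_of_pos hm0 _
  have hη₂0 : 0 < η₂ := Real.rpow_pos_of_pos hm0 _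
  have hU0 : 0 < U := Real.rpow_pos_of_pos hm0 _
  have a1 : η₁ ≤ U := Real.rpow_le_rpow_of_exponent_le hm' (by linarith)
  have a2 : η₂ ≤ U := Real.rpow_le_rpow_of_exponent_le hm' (by linarith)
  have aU : U ≤ 1 := Real.rpow_le_one_of_one_le_of_nonpos hm' (by linarith)
  have b1 : 1 / (m * η₁) = U := by
    rw [hη₁, hU, one_div, ← Real.rpow_one_add' hm0.le (by linarith), ← Real.rpow_neg hm0.le]
    congr 1
    ring
  have b2 : 1 / (m * η₂) ≤ U := by
    rw [hη₂, hU, one_div, ← Real.rpow_one_add' hm0.le (by linarith), ← Real.rpow_neg hm0.le]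
    exact Real.rpow_le_rpow_of_exponent_le hm' (by linarith)
  have c1 : η₁ / η₂ ≤ r := by
    rw [hη₁, hη₂, ← Real.rpow_sub hm0]
    refine le_trans (le_of_eq ?_) hm2.le
    rw [hU]
    congr 1
    ring
  have hBA0 : 0 < B - A := (Real.rpow_pos_of_pos hm0 _).trans_le hBA
  have c2 : η₂ ≤ θ * (B - A) := by
    calc η₂ = (m : ℝ) ^ (-(ε / 2)) * (m : ℝ) ^ (-1 + ε) := by
          rw [hη₂, ← Real.rpow_add hm0]
          congr 1
          ring
      _ ≤ θ * (B - A) := by gcongr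
  have hdet' := fun x => hdet m hmN x A B η₁ η₂ (by linarith) hJ hη₁0 hη₂0 c2 c1
  obtain ⟨e1, e2, -⟩ := hdet' 0
  have hcount := fun x => (hdet' x).2.2
  set w := θ * (B - A)
  have hw0 : 0 < w := by positivity
  have e3 : Icc (A + w) (B - w) ⊆ mpBulk d (κ / 2) :=
    (Icc_subset_Icc (by linarith) (by linarith)).trans e2
  have p1 := hprob m hmN η₁ hη₁0 (a1.trans aU) (by rw [b1]; exact hm1.le) (A - w) (B + w)
    (by linarith) e2
  have p2 := hprob m hmN η₁ hη₁0 (a1.trans aU) (by rw [b1]; exact hm1.le) (A + w) (B - w) e1 e3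
  have p3 := hprob m hmN η₂ hη₂0 (a2.trans aU) (b2.trans hm1.le) (A + w) (B - w) e1 e3
  have hUk : U ^ (2 * q + 2) ≤ (m : ℝ) ^ (-k) := by
    rw [hU, ← Real.rpow_natCast, ← Real.rpow_mul hm0.le]
    refine Real.rpow_le_rpow_of_exponent_le hm' ?_
    have h1 : 4 * k / ε ≤ q := Nat.le_ceil _
    rw [div_le_iff₀ hε] at h1
    push_cast
    nlinarith [mul_nonneg (Nat.cast_nonneg (α := ℝ) q) hε.le]
  have f1 : C * ((1 / (m * η₁)) ^ (2 * q + 2) + η₁ ^ (2 * q + 2)) ≤ 2 * C * (m : ℝ) ^ (-k) := by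
    have g1 : (1 / (m * η₁)) ^ (2 * q + 2) ≤ (m : ℝ) ^ (-k) := by rwa [b1]
    have g2 : η₁ ^ (2 * q + 2) ≤ (m : ℝ) ^ (-k) := (pow_le_pow_left₀ hη₁0.le a1 _).trans hUk
    calc _ ≤ C * ((m : ℝ) ^ (-k) + (m : ℝ) ^ (-k)) := by gcongr
      _ = _ := by ring
  have f2 : C * ((1 / (m * η₂)) ^ (2 * q + 2) + η₂ ^ (2 * q + 2)) ≤ 2 * C * (m : ℝ) ^ (-k) := by
    have g1 : (1 / (m * η₂)) ^ (2 * q + 2) ≤ (m : ℝ) ^ (-k) :=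
      (pow_le_pow_left₀ (by positivity) b2 _).trans hUk
    have g2 : η₂ ^ (2 * q + 2) ≤ (m : ℝ) ^ (-k) := (pow_le_pow_left₀ hη₂0.le a2 _).trans hUk
    calc _ ≤ C * ((m : ℝ) ^ (-k) + (m : ℝ) ^ (-k)) := by gcongr
      _ = _ := by ring
  have hsub : {x : Fin m → ℝ | δ * (B - A) ≤
      |(rescaledCount m d x (Icc A B) : ℝ) / m - ∫ t in A..B, mpDensity d t|}
      ⊆ ({x | γ * (B + w - (A - w)) ≤ ∫ E in (A - w)..(B + w), mpDev d η₁ x E}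
        ∪ {x | γ * (B - w - (A + w)) ≤ ∫ E in (A + w)..(B - w), mpDev d η₁ x E})
        ∪ {x | γ * (B - w - (A + w)) ≤ ∫ E in (A + w)..(B - w), mpDev d η₂ x E} := by
    intro x hx
    by_contra h
    simp only [mem_union, mem_ofPred_eq, not_or, not_le] at h
    exact (hcount x h.1.1 h.1.2 h.2).not_ge hx
  calc _ ≤ _ := measureReal_mono hsub
    _ ≤ _ := measureReal_union_le _ _
    _ ≤ _ := add_le_add_left (measureReal_union_le _ _) _
    _ ≤ _ := by linarith

theorem rescaledCount_mono {m : ℕ} (d : ℝ) (x : Fin m → ℝ) {I J : Set ℝ} (h : I ⊆ J) :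
    (rescaledCount m d x I : ℝ) ≤ rescaledCount m d x J := by
  classical
  rw [rescaledCount_eq_sum, rescaledCount_eq_sum]
  refine Finset.sum_le_sum fun i _ => ?_
  split_ifs with h1 h2 h2
  · exact le_rfl
  · exact (h2 (h h1)).elim
  · exact zero_le_one
  · exact le_rfl

theorem rescaledCount_add_le {m : ℕ} (d : ℝ) (x : Fin m → ℝ) (I J : Set ℝ) :
    (rescaledCount m d x I : ℝ) + rescaledCount m d x J ≤ rescaledCount m d x (I ∩ J) + m := by
  classical
  simp only [rescaledCount_eq_sum]
  have : (m : ℝ) = ∑ _i : Fin m, 1 := by simp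
  rw [this, ← Finset.sum_add_distrib, ← Finset.sum_add_distrib]
  refine Finset.sum_le_sum fun i _ => ?_
  by_cases h1 : d / (m : ℝ) * x i ∈ I <;> by_cases h2 : d / (m : ℝ) * x i ∈ J <;> simp [h1, h2]

theorem rescaledCount_div_le_one {m : ℕ} (d : ℝ) (x : Fin m → ℝ) (I : Set ℝ) :
    (rescaledCount m d x I : ℝ) / m ≤ 1 := by
  classical
  rw [rescaledCount_eq_sum]
  refine div_le_one_of_le₀ ?_ (Nat.cast_nonneg m)
  calc _ ≤ ∑ _i : Fin m, (1 : ℝ) := Finset.sum_le_sum fun i _ => by split_ifs <;> norm_num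
    _ = m := by simp

/-- Passage from the law of two bulk intervals `J = [a, b]`, nearly of full mass, and `W ∩ J` to
the law of an arbitrary interval `W = [A, B]`: outside `J` there is little mass and there are few
points. -/
theorem abs_count_sub_lt_of_bulk (hd : 0 < d) (hd1 : d ≤ 1) {m : ℕ} (hm : 0 < m) {δ a b A B : ℝ}
    (x : Fin m → ℝ) (hle : max A a ≤ min B b)
    (hmass : 1 - δ / 8 < ∫ t in a..b, mpDensity d t)
    (h1 : |(rescaledCount m d x (Icc a b) : ℝ) / m - ∫ t in a..b, mpDensity d t| < δ / 8)
    (h2 : |(rescaledCount m d x (Icc (max A a) (min B b)) : ℝ) / m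
      - ∫ t in (max A a)..(min B b), mpDensity d t| < δ / 8) :
    |(rescaledCount m d x (Icc A B) : ℝ) / m - ∫ t in A..B, mpDensity d t| < δ := by
  have hm' : (0 : ℝ) < m := by exact_mod_cast hm
  have hAB : A ≤ B := (le_max_left _ _).trans (hle.trans (min_le_left _ _))
  have hab : a ≤ b := (le_max_right _ _).trans (hle.trans (min_le_right _ _))
  have hint := integrable_mpDensity hd hd1
  have hI : Icc A B ∩ Icc a b = Icc (max A a) (min B b) := Icc_inter_Icc
  have hn1 := rescaledCount_mono d x (inter_subset_left : Icc A B ∩ Icc a b ⊆ Icc A B)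
  have hn2 := rescaledCount_add_le d x (Icc A B) (Icc a b)
  rw [hI] at hn1 hn2
  have hn1' := div_le_div_of_nonneg_right hn1 hm'.le
  have hn2' := div_le_div_of_nonneg_right hn2 hm'.le
  rw [add_div, add_div, div_self hm'.ne'] at hn2'
  have hR : ∀ {u v : ℝ}, u ≤ v → ∫ t in u..v, mpDensity d t = ∫ t in Icc u v, mpDensity d t :=
    fun h => by rw [intervalIntegral.integral_of_le h, integral_Icc_eq_integral_Ioc]
  have hm1 : ∫ t in (max A a)..(min B b), mpDensity d t ≤ ∫ t in A..B, mpDensity d t := by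
    rw [hR hle, hR hAB, ← hI]
    exact setIntegral_mono_set hint.integrableOn (Eventually.of_forall (mpDensity_nonneg hd))
      inter_subset_left.eventuallyLE
  have hm2 : (∫ t in A..B, mpDensity d t) + ∫ t in a..b, mpDensity d t
      ≤ (∫ t in (max A a)..(min B b), mpDensity d t) + 1 := by
    rw [hR hle, hR hAB, hR hab, ← hI]
    have h3 := integral_inter_add_sdiff (μ := volume) (f := mpDensity d) (s := Icc A B)
      (measurableSet_Icc (a := a) (b := b)) hint.integrableOn
    have h4 : ∫ t in Icc A B \ Icc a b, mpDensity d t ≤ ∫ t in (Icc a b)ᶜ, mpDensity d t :=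
      setIntegral_mono_set hint.integrableOn (Eventually.of_forall (mpDensity_nonneg hd))
        (LE.le.eventuallyLE fun t ht => ht.2)
    have h5 := integral_add_compl (measurableSet_Icc (a := a) (b := b)) hint
    rw [integral_mpDensity_univ hd hd1] at h5
    linarith
  rw [abs_lt] at *
  constructor <;> linarith [h1.1, h1.2, h2.1, h2.2]

/-- A polynomial bound for large `m` extends to all `m ≥ 1` since probabilities are at most `1`. -/
theorem exists_bound_of_eventually {S : Set ℝ} {f : ℕ → ℝ → ℝ} {k : ℝ} (hk : 0 ≤ k)
    (hf1 : ∀ m E, 1 ≤ m → f m E ≤ 1) {C : ℝ}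
    (h : ∀ᶠ m : ℕ in atTop, ∀ E ∈ S, f m E ≤ C * (m : ℝ) ^ (-k)) :
    ∃ C : ℝ, ∀ m : ℕ, 1 ≤ m → ∀ E ∈ S, f m E ≤ C * (m : ℝ) ^ (-k) := by
  obtain ⟨N, hN⟩ := eventually_atTop.1 h
  refine ⟨max C ((N : ℝ) ^ k), fun m hm E hE => ?_⟩
  have hm0 : (0 : ℝ) < m := by exact_mod_cast hm
  have hp : 0 < (m : ℝ) ^ (-k) := Real.rpow_pos_of_pos hm0 _
  rcases le_or_gt N m with h1 | h1
  · exact (hN m h1 E hE).trans (by gcongr; exact le_max_left _ _)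
  · refine (hf1 m E hm).trans ?_
    calc 1 = (m : ℝ) ^ k * (m : ℝ) ^ (-k) := by
          rw [← Real.rpow_add hm0, add_neg_cancel, Real.rpow_zero]
      _ ≤ (N : ℝ) ^ k * (m : ℝ) ^ (-k) := by gcongr
      _ ≤ _ := by gcongr; exact le_max_right _ _

end

theorem theorem1 (β d : ℝ) (hβ : 0 < β) (hd : 0 < d) (hd1 : d ≤ 1)
    (δ κ ε : ℝ) (hδ : 0 < δ) (hκ : 0 < κ) (hε : 0 < ε) (k : ℝ) (hk : 0 < k) :
    ∃ C : ℝ, ∀ m : ℕ, 1 ≤ m → ∀ E ∈ Set.Ioo (mpLower d + κ) (mpUpper d - κ),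
      (laguerreEnsemble m β (m * β / (2 * d))).real
        {x : Fin m → ℝ |
          δ * (m : ℝ) ^ (-1 + ε) ≤
            |(rescaledCount m d x
                (Set.Icc (E - (m : ℝ) ^ (-1 + ε)) (E + (m : ℝ) ^ (-1 + ε))) : ℝ) / m
              - ∫ t in (E - (m : ℝ) ^ (-1 + ε))..(E + (m : ℝ) ^ (-1 + ε)), mpDensity d t|}
        ≤ C * (m : ℝ) ^ (-k) := by
  have hprob : ∀ m : ℕ, IsProbabilityMeasure (laguerreEnsemble m β (m * β / (2 * d))) := fun m =>
    isProbabilityMeasure_laguerreEnsemble' m β d hβ hd hd1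
  suffices h : ∃ C : ℝ, ∀ᶠ m : ℕ in atTop, ∀ E ∈ Set.Ioo (mpLower d + κ) (mpUpper d - κ),
      (laguerreEnsemble m β (m * β / (2 * d))).real
        {x : Fin m → ℝ |
          δ * (m : ℝ) ^ (-1 + ε) ≤
            |(rescaledCount m d x
                (Set.Icc (E - (m : ℝ) ^ (-1 + ε)) (E + (m : ℝ) ^ (-1 + ε))) : ℝ) / m
              - ∫ t in (E - (m : ℝ) ^ (-1 + ε))..(E + (m : ℝ) ^ (-1 + ε)), mpDensity d t|}
        ≤ C * (m : ℝ) ^ (-k) by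
    obtain ⟨C, hC⟩ := h
    exact exists_bound_of_eventually hk.le (fun m E _ => measureReal_le_one) hC
  rcases lt_trichotomy ε 1 with hε1 | hε1 | hε1
  · -- windows shrinking into the bulk
    obtain ⟨C, hC⟩ := exists_bulk_law hβ hd hd1 (half_pos hκ) (half_pos hδ) hε hε1.le k
    refine ⟨C, ?_⟩
    have hlim := tendsto_natCast_rpow_neg (s := 1 - ε) (by linarith)
    filter_upwards [hC, hlim.eventually (gt_mem_nhds (half_pos hκ))] with m hm hm2 E hE
    rw [neg_sub, sub_eq_neg_add] at hm2
    set h : ℝ := (m : ℝ) ^ (-1 + ε)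
    have hh : 0 ≤ h := Real.rpow_nonneg (Nat.cast_nonneg m) _
    have := hm (E - h) (E + h)
      (fun t ht => ⟨by linarith [ht.1, hE.1], by linarith [ht.2, hE.2]⟩) (by linarith)
    rwa [show δ / 2 * (E + h - (E - h)) = δ * h by ring] at this
  · -- windows of fixed length, which may contain the edges of the spectrum
    subst hε1
    simp only [neg_add_cancel, Real.rpow_zero, mul_one]
    obtain ⟨κ', ⟨hmass, hκ'⟩, hκ'0⟩ := (((eventually_lt_integral_mpBulk hd hd1
      (c := 1 - δ / 8) (by linarith)).and (eventually_nhdsWithin_of_eventually_nhds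
        (gt_mem_nhds (half_pos hκ)))).and self_mem_nhdsWithin).exists
    have hκ'0 : 0 < κ' := hκ'0
    obtain ⟨C, hC⟩ := exists_bulk_law hβ hd hd1 hκ'0 (δ := δ / 32) (by positivity)
      (ε := 1 / 2) (by norm_num) (by norm_num) k
    refine ⟨2 * C, ?_⟩
    have hlim := tendsto_natCast_rpow_neg (s := 1 / 2) (by norm_num)
    filter_upwards [hC, hlim.eventually (gt_mem_nhds (lt_min one_pos (half_pos hκ))),
      eventually_ge_atTop 1] with m hm hm2 hm1 E hE
    rw [show (-(1 / 2) : ℝ) = -1 + 1 / 2 by norm_num] at hm2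
    obtain ⟨hm2, hm3⟩ := lt_min_iff.1 hm2
    set h : ℝ := (m : ℝ) ^ (-1 + 1 / 2 : ℝ)
    have hh : 0 ≤ h := Real.rpow_nonneg (Nat.cast_nonneg m) _
    set a := mpLower d + κ' with ha
    set b := mpUpper d - κ' with hb
    have hl : max (E - 1) a ≤ E - h := max_le (by linarith) (by linarith [hE.1])
    have hr : E + h ≤ min (E + 1) b := le_min (by linarith) (by linarith [hE.2])
    have hJ : Icc a b ⊆ mpBulk d κ' := subset_rfl
    have hJ' : Icc (max (E - 1) a) (min (E + 1) b) ⊆ mpBulk d κ' :=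
      Icc_subset_Icc (le_max_right _ _) (min_le_right _ _)
    have hlen : b - a ≤ 4 := by
      linarith [mpUpper_le hd1, mpLower_nonneg (d := d)]
    have p1 := hm a b hJ (by linarith [le_max_right (E - 1) a, min_le_right (E + 1) b])
    have p2 := hm _ _ hJ' (by linarith)
    have hsub : {x : Fin m → ℝ | δ ≤ |(rescaledCount m d x (Icc (E - 1) (E + 1)) : ℝ) / m
        - ∫ t in (E - 1)..(E + 1), mpDensity d t|}
        ⊆ {x | δ / 32 * (b - a) ≤ |(rescaledCount m d x (Icc a b) : ℝ) / m
            - ∫ t in a..b, mpDensity d t|}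
          ∪ {x | δ / 32 * (min (E + 1) b - max (E - 1) a) ≤
            |(rescaledCount m d x (Icc (max (E - 1) a) (min (E + 1) b)) : ℝ) / m
              - ∫ t in (max (E - 1) a)..(min (E + 1) b), mpDensity d t|} := by
      intro x hx
      by_contra hcon
      simp only [mem_union, mem_ofPred_eq, not_or, not_le] at hcon
      refine (abs_count_sub_lt_of_bulk hd hd1 hm1 x (by linarith) hmass
        (hcon.1.trans_le ?_) (hcon.2.trans_le ?_)).not_ge hx
      · nlinarith
      · nlinarith [le_max_right (E - 1) a, min_le_right (E + 1) b]
    calc _ ≤ _ := measureReal_mono hsub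
      _ ≤ _ := measureReal_union_le _ _
      _ ≤ _ := by linarith
  · -- windows of diverging length: the deviation never exceeds `1`
    refine ⟨0, ?_⟩
    have hlim := (tendsto_rpow_atTop (y := -1 + ε) (by linarith)).comp
      (tendsto_natCast_atTop_atTop (R := ℝ))
    filter_upwards [hlim.eventually_gt_atTop (1 / δ)] with m hm E hE
    simp only [Function.comp_apply] at hm
    rw [div_lt_iff₀ hδ] at hm
    set h : ℝ := (m : ℝ) ^ (-1 + ε)
    have hh : 0 ≤ h := Real.rpow_nonneg (Nat.cast_nonneg m) _
    have hempty : {x : Fin m → ℝ | δ * h ≤ |(rescaledCount m d x (Icc (E - h) (E + h)) : ℝ) / m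
        - ∫ t in (E - h)..(E + h), mpDensity d t|} = ∅ := by
      refine eq_empty_of_forall_notMem fun x hx => ?_
      have hx' : δ * h ≤ |(rescaledCount m d x (Icc (E - h) (E + h)) : ℝ) / m
        - ∫ t in (E - h)..(E + h), mpDensity d t| := hx
      have h1 := rescaledCount_div_le_one d x (Icc (E - h) (E + h))
      have h2 : 0 ≤ (rescaledCount m d x (Icc (E - h) (E + h)) : ℝ) / m := by positivity
      have h3 := integral_mpDensity_le_one hd hd1 (A := E - h) (B := E + h) (by linarith)
      have h4 : 0 ≤ ∫ t in (E - h)..(E + h), mpDensity d t :=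
        intervalIntegral.integral_nonneg (by linarith) fun t _ => mpDensity_nonneg hd t
      have h5 : |(rescaledCount m d x (Icc (E - h) (E + h)) : ℝ) / m
          - ∫ t in (E - h)..(E + h), mpDensity d t| ≤ 1 :=
        abs_le.2 ⟨by linarith, by linarith⟩
      linarith
    rw [hempty, measureReal_empty, zero_mul]
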